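/- \textbf{Theorem (Global dynamics).} Let $m,n>1$ be integers and $k_g=k_h=-1$. Consider on $\mathbb{R}^4\ni(A,B,P,Q)$ the autonomous system $$A'=A\,[P-\sigma],\qquad B'=B\,[Q-\sigma],\qquad P'=P\,[1-\sigma]+(m+n-1)k_gA^2,\qquad Q'=Q\,[1-\sigma]+(m+n-1)k_hB^2,$$ with $\sigma=mP^2+nQ^2$ and $'=d/d\tau$. Let $\mathcal S$ be the set of $(A,B,P,Q)$ with $A>0$, $B>0$, $mP+nQ=1$ and $\sigma-(m+n-1)(k_g m A^2+k_h n B^2)=1$, and let $\bar{\mathcal S}$ be its closure (a compact quarter ellipsoid). Define the points $$\mathrm F_{1}:\ A=B=0,\ P=\tfrac{1}{m+n}\Big(1+ n\sqrt{\tfrac{m+n-1}{mn}}\Big),\ Q=\tfrac1{m+n}\Big(1- m\sqrt{\tfrac{m+n-1}{mn}}\Big),$$ $$\mathrm F_{2}:\ A=B=0,\ P=\tfrac{1}{m+n}\Big(1- n\sqrt{\tfrac{m+n-1}{mn}}\Big),\ Q=\tfrac1{m+n}\Big(1+ m\sqrt{\tfrac{m+n-1}{mn}}\Big),$$ $$\mathrm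 F_A:\ A=0,\ B=\sqrt{\tfrac{n-1}{n^2}\tfrac{1}{m+n-1}},\ P=0,\ Q=\tfrac1n,\qquad \mathrm F_B:\ A=\sqrt{\tfrac{m-1}{m^2}\tfrac{1}{m+n-1}},\ B=0,\ P=\tfrac1m,\ Q=0,$$ $$\mathrm F_*:\ A=B=P=Q=\tfrac1{m+n}.$$ Then the system defines a unique flow, complete in $\tau\in\mathbb{R}$, on $\bar{\mathcal S}$, and the following hold for its orbits. \begin{enumerate} \item For every orbit in $\bar{\mathcal S}$ with $A=0$, $B\ne0$ that is different from $\mathrm F_A$, the $\alpha$-limit set is $\{\mathrm F_A\}$ and the $\omega$-limit set is $\{\mathrm F_1\}$ or $\{\mathrm F_2\}$. For every orbit in $\bar{\mathcal S}$ with $A\neq 0$, $B=0$ that is different from $\mathrm F_B$, the $\alpha$-limit set is $\{\mathrm F_B\}$ and the $\omega$-limit set is $\{\mathrm F_1\}$ or $\{\mathrm F_2\}$. \item For every orbit in $\bar{\mathcal S}$ with $AB\neq0$ that is different from $\mathrm F_*$, the $\alpha$-limit set is $\{\mathrm F_*\}$. Exactly one orbit with $AB\ne 0$ has $\omega$-limit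 set $\{\mathrm F_A\}$, and exactly one has $\omega$-limit set $\{\mathrm F_B\}$. Every other orbit with $AB\ne0$ that is different from $\mathrm F_*$ has $\omega$-limit set $\{\mathrm F_1\}$ or $\{\mathrm F_2\}$, and the points with $AB\neq 0$ on these orbits form an open dense subset of $\bar{\mathcal S}$. \end{enumerate} -/

import Mathlib

open scoped omegaLimit

noncomputable section

namespace WarpedProduct

/-- The space `ℝ⁴` of the scale invariant variables, with coordinates
`x 0 = A`, `x 1 = B`, `x 2 = P`, `x 3 = Q`. -/
abbrev State : Type := Fin 4 → ℝ

/-- The quadratic expression `m P² + n Q²`. -/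
def shearSum (m n : ℕ) (x : State) : ℝ := m * x 2 ^ 2 + n * x 3 ^ 2

/-- The right-hand side of the autonomous system for `(A, B, P, Q)`. -/
def vectorField (m n : ℕ) (kg kh : ℝ) (x : State) : State :=
  ![x 0 * (x 2 - shearSum m n x),
    x 1 * (x 3 - shearSum m n x),
    x 2 * (1 - shearSum m n x) + (m + n - 1) * kg * x 0 ^ 2,
    x 3 * (1 - shearSum m n x) + (m + n - 1) * kh * x 1 ^ 2]

/-- The trace constraint function `C₁ = m P + n Q - 1`. -/
def traceConstraint (m n : ℕ) (x : State) : ℝ := m * x 2 + n * x 3 - 1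

/-- The Hamiltonian constraint function
`C₂ = (m P² + n Q²) - (m + n - 1) (k_g m A² + k_h n B²) - 1`. -/
def hamiltonianConstraint (m n : ℕ) (kg kh : ℝ) (x : State) : ℝ :=
  shearSum m n x - (m + n - 1) * (kg * m * x 0 ^ 2 + kh * n * x 1 ^ 2) - 1

/-- The physical state space `S`: both constraints hold, `A > 0` and `B > 0`. -/
def stateSpace (m n : ℕ) (kg kh : ℝ) : Set State :=
  {x | traceConstraint m n x = 0 ∧ hamiltonianConstraint m n kg kh x = 0 ∧ 0 < x 0 ∧ 0 < x 1}

/-- The closure of the physical state space in `ℝ⁴`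
(for `k_g = k_h = -1` and `m, n > 1` a compact quarter ellipsoid). -/
def closedStateSpace (m n : ℕ) (kg kh : ℝ) : Set State := closure (stateSpace m n kg kh)

/-- `φ` is the flow of the dynamical system on the closed state space: each of its trajectories
is an integral curve of the vector field. -/
def IsSystemFlow (m n : ℕ) (kg kh : ℝ) (φ : Flow ℝ (closedStateSpace m n kg kh)) : Prop :=
  ∀ (x : closedStateSpace m n kg kh) (τ : ℝ),
    HasDerivAt (fun s : ℝ => (φ s x : State)) (vectorField m n kg kh (φ τ x)) τ

/-- The `ω`-limit set of the orbit through `x`, as a subset of `ℝ⁴`. -/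
def omegaSet {X : Set State} (φ : Flow ℝ X) (x : X) : Set State :=
  Subtype.val '' ω⁺ φ {x}

/-- The `α`-limit set of the orbit through `x`, as a subset of `ℝ⁴`. -/
def alphaSet {X : Set State} (φ : Flow ℝ X) (x : X) : Set State :=
  Subtype.val '' ω⁻ φ {x}

/-- The equilibrium `F₁`: `A = B = 0`, and `(P, Q)` is the solution of
`m P + n Q = 1`, `m P² + n Q² = 1` with `P > 0 > Q`. -/
def F1 (m n : ℕ) : State :=
  ![0, 0,
    1 / (m + n) * (1 + n * Real.sqrt ((m + n - 1) / (m * n))),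
    1 / (m + n) * (1 - m * Real.sqrt ((m + n - 1) / (m * n)))]

/-- The equilibrium `F₂`: `A = B = 0`, and `(P, Q)` is the solution of
`m P + n Q = 1`, `m P² + n Q² = 1` with `P < 0 < Q`. -/
def F2 (m n : ℕ) : State :=
  ![0, 0,
    1 / (m + n) * (1 - n * Real.sqrt ((m + n - 1) / (m * n))),
    1 / (m + n) * (1 + m * Real.sqrt ((m + n - 1) / (m * n)))]

/-- The equilibrium `F_A`: `A = 0`, `B² = (n - 1) / (n² (m + n - 1))`, `P = 0`, `Q = 1 / n`. -/
def FA (m n : ℕ) : State :=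
  ![0, Real.sqrt ((n - 1) / n ^ 2 * (1 / (m + n - 1))), 0, 1 / n]

/-- The equilibrium `F_B`: `A² = (m - 1) / (m² (m + n - 1))`, `B = 0`, `P = 1 / m`, `Q = 0`. -/
def FB (m n : ℕ) : State :=
  ![Real.sqrt ((m - 1) / m ^ 2 * (1 / (m + n - 1))), 0, 1 / m, 0]

/-- The equilibrium `F_*`: `A = B = P = Q = 1 / (m + n)`. -/
def Fstar (m n : ℕ) : State := fun _ => 1 / (m + n)

end WarpedProduct

end

/-! Multiplying the field by a bump function that is 1 near the compact state space gives a bounded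
Lipschitz field with a global flow. The constraints, `A` and `B` obey scalar linear equations along
it, so the state space and its closure are invariant.

Three monotone quantities drive the dynamics through LaSalle's principle. Since `P' = (1 - σ) P - (m
+ n - 1) A²` and `σ ≤ 1`, a negative `P` stays negative and decreases, which forces convergence to
`F2`; likewise `Q < 0` leads to `F1`. On `A = 0` the function `P²` increases, so orbits run from
`F_A` to `F1` or `F2`. For `A B ≠ 0` the function `A ^ m * B ^ n` has derivative `-m n (P - Q)²`
times itself, so orbits leave `F_*` and approach the boundary. If `P` and `Q` never become negative,
invariance of the limit set leaves only `F_A` and `F_B` (`omegaLimit_cases`).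

At most one interior orbit tends to `F_A`, by a cone estimate for the difference of two solutions
(`eq_of_tendsto_of_A_eq`). One exists by shooting along a segment on which `P` can leave an interval
through either end (`exists_forall_P_mem_Ioo`). These replace the stable manifold theorem.

The basins of `F1` and `F2` are the sets where `Q` or `P` is somewhere negative, hence open. Their
complement in the interior is three orbits, which have Hausdorff dimension at most 1 in a planar
chart. Exchanging the factors (`symm`) gives every statement about `F_B` from that about `F_A`. -/

open Filter Topology Set
open scoped NNReal

/-! ### Global flows and scalar linear differential equations. -/

/-- A bounded Lipschitz vector field on a Banach space generates a global flow. -/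
theorem exists_flow_of_lipschitzWith_of_bounded {E : Type*} [NormedAddCommGroup E]
    [NormedSpace ℝ E] [CompleteSpace E] {f : E → E} {K M : ℝ≥0} (hf : LipschitzWith K f)
    (hM : ∀ x, ‖f x‖ ≤ M) :
    ∃ φ : Flow ℝ E, ∀ x t, HasDerivAt (fun s => φ s x) (f (φ t x)) t := by
  have key : ∀ (x : E) (N : ℕ), ∃ α : ℝ → E, α 0 = x ∧
      ∀ t ∈ Ioo (-((N : ℝ) + 1)) (N + 1), HasDerivAt α (f (α t)) t := by
    intro x N
    have h0 : (0 : ℝ) ∈ Icc (-((N : ℝ) + 1)) (N + 1) := ⟨by linarith [N.cast_nonneg (α := ℝ)],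
      by positivity⟩
    -- A trajectory of speed at most `M` stays within `M * (N + 1)` of `x` during this time, so
    -- global bounds permit every `N`.
    have hP : IsPicardLindelof (fun _ ↦ f) (⟨0, h0⟩ : Icc (-((N : ℝ) + 1)) (N + 1)) x
        (M * (N + 1)) 0 M K :=
      IsPicardLindelof.of_time_independent (fun y _ => hM y) hf.lipschitzOnWith (by simp)
    obtain ⟨α, h1, h2⟩ := hP.exists_eq_forall_mem_Icc_hasDerivWithinAt₀
    exact ⟨α, h1, fun t ht => (h2 t (Ioo_subset_Icc_self ht)).hasDerivAt (Icc_mem_nhds ht.1 ht.2)⟩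
  choose α h0 hα using key
  have huniq : ∀ (x : E) (N N' : ℕ) (t : ℝ), |t| < N + 1 → |t| < N' + 1 → α x N t = α x N' t := by
    intro x N N' t h h'
    have hN : ∀ L L' : ℕ, L ≤ L' → |t| < L + 1 → α x L t = α x L' t := by
      intro L L' hle hL
      have hle' : (L : ℝ) ≤ L' := by exact_mod_cast hle
      have hL' := abs_lt.1 hL
      refine ODE_solution_unique_of_mem_Ioo (v := fun _ => f) (s := fun _ => univ) (K := K)
        (t₀ := 0) (a := -((L : ℝ) + 1)) (b := L + 1) (fun _ _ => hf.lipschitzOnWith)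
        ⟨by linarith [L.cast_nonneg (α := ℝ)], by positivity⟩
        (fun s hs => ⟨hα x L s hs, trivial⟩)
        (fun s hs => ⟨hα x L' s ⟨by linarith [hs.1], by linarith [hs.2]⟩, trivial⟩)
        (by rw [h0, h0]) hL'
    rcases le_total N N' with hle | hle
    · exact hN _ _ hle h
    · exact (hN _ _ hle h').symm
  -- The local solution of index `⌈|t|⌉₊` lives on an interval longer by 1 on each side, so `t` is
  -- interior and derivatives carry over from local solutions.
  let X : ℝ → E → E := fun t x => α x ⌈|t|⌉₊ t
  have hceil : ∀ t : ℝ, |t| < (⌈|t|⌉₊ : ℝ) + 1 := fun t => (Nat.le_ceil _).trans_lt (lt_add_one _)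
  have hX : ∀ x t, HasDerivAt (fun s => X s x) (f (X t x)) t := by
    intro x t
    have ht := abs_lt.1 (hceil t)
    refine (hα x _ t ht).congr_of_eventuallyEq ?_
    filter_upwards [Ioo_mem_nhds ht.1 ht.2] with s hs
    exact huniq x _ _ s (hceil s) (abs_lt.2 hs)
  have hX0 : ∀ x, X 0 x = x := fun x => h0 _ _
  have huni : ∀ (g h : ℝ → E), (∀ t, HasDerivAt g (f (g t)) t) → (∀ t, HasDerivAt h (f (h t)) t) →
      g 0 = h 0 → g = h := fun g h hg hh he =>
    ODE_solution_unique_univ (v := fun _ => f) (s := fun _ => univ) (K := K)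
      (fun _ => hf.lipschitzOnWith) (fun t => ⟨hg t, trivial⟩) (fun t => ⟨hh t, trivial⟩) he
  have hadd : ∀ s t x, X (s + t) x = X s (X t x) := by
    intro s t x
    refine congrFun (huni (fun s => X (s + t) x) (fun s => X s (X t x)) (fun r => ?_) (hX _) ?_) s
    · exact (hX x (r + t)).comp_add_const r t
    · simp [hX0]
  -- Grönwall's bound, locally uniform in `t`, turns continuity in time into joint continuity.
  -- Negative times follow by reversing the field.
  have hgron : ∀ x y t, dist (X t x) (X t y) ≤ dist x y * Real.exp (K * |t|) := by
    intro x y t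
    have hpos : ∀ (g : E → E), LipschitzWith K g → ∀ (u v : ℝ → E),
        (∀ t, HasDerivAt u (g (u t)) t) → (∀ t, HasDerivAt v (g (v t)) t) → ∀ t, 0 ≤ t →
        dist (u t) (v t) ≤ dist (u 0) (v 0) * Real.exp (K * t) := by
      intro g hg u v hu hv t ht
      have := dist_le_of_trajectories_ODE (v := fun _ => g) (K := K) (f := u) (g := v)
        (a := 0) (b := t) (fun _ => hg) (HasDerivAt.continuousOn fun s _ => hu s)
        (fun s _ => (hu s).hasDerivWithinAt) (HasDerivAt.continuousOn fun s _ => hv s)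
        (fun s _ => (hv s).hasDerivWithinAt) le_rfl t ⟨ht, le_rfl⟩
      simpa using this
    rcases le_total 0 t with ht | ht
    · simpa [abs_of_nonneg ht, hX0] using
        hpos f hf (fun s => X s x) (fun s => X s y) (hX x) (hX y) t ht
    · have hrev : ∀ z s, HasDerivAt (fun s => X (-s) z) (-f (X (-s) z)) s := by
        intro z s
        simpa [Function.comp_def] using (hX z (-s)).scomp s (hasDerivAt_neg s)
      simpa [abs_of_nonpos ht, hX0] using hpos (fun z => -f z) hf.neg (fun s => X (-s) x)
        (fun s => X (-s) y) (hrev x) (hrev y) (-t) (by linarith)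
  refine ⟨⟨X, ?_, hadd, hX0⟩, hX⟩
  rw [continuous_iff_continuousAt]
  rintro ⟨t₀, x₀⟩
  rw [ContinuousAt, tendsto_iff_dist_tendsto_zero]
  have hc : Continuous fun s => X s x₀ :=
    continuous_iff_continuousAt.2 fun t => (hX x₀ t).continuousAt
  have hlim : Tendsto (fun p : ℝ × E => dist p.2 x₀ * Real.exp (K * |p.1|) +
      dist (X p.1 x₀) (X t₀ x₀)) (𝓝 (t₀, x₀)) (𝓝 0) := by
    have : Continuous fun p : ℝ × E => dist p.2 x₀ * Real.exp (K * |p.1|) +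
        dist (X p.1 x₀) (X t₀ x₀) := by fun_prop
    simpa using this.tendsto (t₀, x₀)
  refine squeeze_zero (fun _ => dist_nonneg) (fun p => ?_) hlim
  exact (dist_triangle _ (X p.1 x₀) _).trans (add_le_add_left (hgron _ _ _) _)

/-- A solution of a scalar linear homogeneous equation is a positive multiple of its initial
value. -/
theorem exists_pos_mul_of_hasDerivAt_mul_self {y a : ℝ → ℝ} (ha : Continuous a)
    (hy : ∀ t, HasDerivAt y (a t * y t) t) (t : ℝ) : ∃ c, 0 < c ∧ y t = c * y 0 := by
  set I : ℝ → ℝ := fun t => ∫ s in (0 : ℝ)..t, a s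
  have hI : ∀ t, HasDerivAt I (a t) t := fun t => ha.integral_hasStrictDerivAt 0 t |>.hasDerivAt
  have hd : ∀ t, HasDerivAt (fun t => y t * Real.exp (-I t)) 0 t := by
    intro t
    convert! (hy t).mul (hI t).neg.exp using 1
    simp only [Pi.neg_apply]
    ring
  have hconst := is_const_of_deriv_eq_zero (fun t => (hd t).differentiableAt)
    (fun t => (hd t).deriv) t 0
  refine ⟨Real.exp (I t), Real.exp_pos _, ?_⟩
  have hI0 : I 0 = 0 := by simp [I]
  simp only [hI0, neg_zero, Real.exp_zero, mul_one] at hconst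
  rw [← hconst, mul_comm, mul_assoc, ← Real.exp_add]
  simp

/-- A solution of a scalar linear equation with nonpositive forcing is bounded above by a positive
multiple of its initial value. -/
theorem exists_pos_le_mul_of_hasDerivAt {y a b : ℝ → ℝ} (ha : Continuous a) (hb : ∀ t, 0 ≤ b t)
    (hy : ∀ t, HasDerivAt y (a t * y t - b t) t) {s t : ℝ} (hst : s ≤ t) :
    ∃ c, 0 < c ∧ y t ≤ c * y s := by
  set I : ℝ → ℝ := fun t => ∫ s in (0 : ℝ)..t, a s
  have hI : ∀ t, HasDerivAt I (a t) t := fun t => ha.integral_hasStrictDerivAt 0 t |>.hasDerivAt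
  have hd : ∀ t, HasDerivAt (fun t => y t * Real.exp (-I t)) (-(b t * Real.exp (-I t))) t := by
    intro t
    convert! (hy t).mul (hI t).neg.exp using 1
    simp only [Pi.neg_apply]
    ring
  have hanti : Antitone fun t => y t * Real.exp (-I t) :=
    antitone_of_hasDerivAt_nonpos hd fun t => by
      simpa using mul_nonneg (hb t) (Real.exp_pos (-I t)).le
  refine ⟨Real.exp (-I s) * Real.exp (I t), by positivity, ?_⟩
  have := mul_le_mul_of_nonneg_right (hanti hst) (Real.exp_pos (I t)).le
  simp only [mul_assoc, ← Real.exp_add, neg_add_cancel, Real.exp_zero, mul_one] at this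
  rw [← Real.exp_add, mul_comm]
  exact this

theorem AntitoneOn.exists_tendsto_atTop {g : ℝ → ℝ} {s b : ℝ} (hg : AntitoneOn g (Ici s))
    (hb : ∀ t, b ≤ g t) : ∃ c, c ≤ g s ∧ Tendsto g atTop (𝓝 c) := by
  have hanti : Antitone fun t => g (max t s) := fun t t' h =>
    hg (mem_Ici.2 (le_max_right t s)) (mem_Ici.2 (le_max_right t' s)) (max_le_max_right s h)
  have hlim := tendsto_atTop_ciInf hanti ⟨b, by rintro _ ⟨t, rfl⟩; exact hb _⟩
  refine ⟨_, ?_, hlim.congr' ?_⟩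
  · exact le_of_tendsto hlim (by
      filter_upwards [eventually_ge_atTop s] with t ht
      exact hg self_mem_Ici (mem_Ici.2 (le_max_right t s)) (le_max_right t s))
  · filter_upwards [eventually_ge_atTop s] with t ht
    rw [max_eq_left ht]

/-! ### Limit sets and LaSalle's principle. -/

namespace Flow

variable {X : Type*} [TopologicalSpace X] {φ : Flow ℝ X} {x y : X} {f : Filter ℝ} {W : X → ℝ}
  {c : ℝ}

theorem eq_of_mem_omegaLimit_of_tendsto (hW : Continuous W)
    (hlim : Tendsto (fun t => W (φ t x)) f (𝓝 c)) (hy : y ∈ ω f φ {x}) : W y = c := by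
  rw [mem_omegaLimit_singleton_iff_mapClusterPt] at hy
  have h : MapClusterPt (W y) f fun t => W (φ t x) := hy.continuousAt_comp hW.continuousAt
  have : (𝓝 (W y) ⊓ 𝓝 c).NeBot := NeBot.mono h (inf_le_inf_left _ hlim)
  exact eq_of_nhds_neBot this

theorem omegaLimit_subset_of_isClosed {C : Set X} (hC : IsClosed C) (h : ∀ᶠ t in f, φ t x ∈ C) :
    ω f φ {x} ⊆ C := by
  refine (omegaLimit_subset_closure_image2 f φ {x} h).trans (closure_minimal ?_ hC)
  rintro _ ⟨t, ht, _, rfl, rfl⟩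
  exact ht

theorem map_mem_omegaLimit (hf : ∀ t, Tendsto (t + ·) f f) (hy : y ∈ ω f φ {x}) (t : ℝ) :
    φ t y ∈ ω f φ {x} :=
  isInvariant_omegaLimit f φ {x} hf t hy

theorem omegaLimit_subset_omegaLimit (hf : ∀ t, Tendsto (t + ·) f f) (hy : y ∈ ω f φ {x}) :
    ω f φ {y} ⊆ ω f φ {x} :=
  omegaLimit_subset_of_isClosed (isClosed_omegaLimit f φ {x})
    (Eventually.of_forall fun t => map_mem_omegaLimit hf hy t)

/-- LaSalle's principle: the orbital derivative of a function that converges along an orbit vanishes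
on the limit set of that orbit. -/
theorem hasDerivAt_eq_zero_of_mem_omegaLimit (hf : ∀ t, Tendsto (t + ·) f f) (hW : Continuous W)
    (hlim : Tendsto (fun t => W (φ t x)) f (𝓝 c)) (hy : y ∈ ω f φ {x}) {d t : ℝ}
    (hd : HasDerivAt (fun s => W (φ s y)) d t) : d = 0 := by
  have : (fun s => W (φ s y)) = fun _ => c := funext fun s =>
    eq_of_mem_omegaLimit_of_tendsto hW hlim (map_mem_omegaLimit hf hy s)
  rw [this] at hd
  exact hd.unique (hasDerivAt_const t c)

theorem tendsto_of_forall_omegaLimit [CompactSpace X] (hW : Continuous W)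
    (h : ∀ y ∈ ω f φ {x}, W y = c) : Tendsto (fun t => W (φ t x)) f (𝓝 c) := by
  rw [tendsto_def]
  intro s hs
  obtain ⟨u, hus, huo, hcu⟩ := mem_nhds_iff.1 hs
  filter_upwards [eventually_mapsTo_of_isOpen_of_omegaLimit_subset f φ {x} (huo.preimage hW)
    fun y hy => by simpa [h y hy] using hcu] with t ht
  exact hus (ht rfl)

end Flow

/-! ### The state space and its flow. -/

namespace WarpedProduct

variable {m n : ℕ}

theorem contDiff_vectorField (m n : ℕ) (kg kh : ℝ) : ContDiff ℝ 1 (vectorField m n kg kh) := by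
  rw [contDiff_pi]
  intro i
  fin_cases i <;> simp [vectorField, shearSum] <;> fun_prop

theorem closedStateSpace_subset (m n : ℕ) (kg kh : ℝ) :
    closedStateSpace m n kg kh ⊆ {x | traceConstraint m n x = 0 ∧
      hamiltonianConstraint m n kg kh x = 0 ∧ 0 ≤ x 0 ∧ 0 ≤ x 1} := by
  refine closure_minimal (fun x hx => ⟨hx.1, hx.2.1, hx.2.2.1.le, hx.2.2.2.le⟩) ?_
  refine (isClosed_eq ?_ continuous_const).inter ((isClosed_eq ?_ continuous_const).inter
    ((isClosed_le continuous_const (continuous_apply 0)).inter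
      (isClosed_le continuous_const (continuous_apply 1))))
  · unfold traceConstraint; fun_prop
  · unfold hamiltonianConstraint shearSum; fun_prop

theorem closedStateSpace_subset_closedBall (hm : 1 < m) (hn : 1 < n) :
    closedStateSpace m n (-1) (-1) ⊆ Metric.closedBall 0 1 := by
  intro x hx
  obtain ⟨-, hx, -, -⟩ := closedStateSpace_subset _ _ _ _ hx
  have hm' : (2 : ℝ) ≤ m := by exact_mod_cast hm
  have hn' : (2 : ℝ) ≤ n := by exact_mod_cast hn
  simp only [hamiltonianConstraint, shearSum] at hx
  have hN : (1 : ℝ) ≤ m + n - 1 := by linarith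
  have h0 : x 0 ^ 2 ≤ (m + n - 1) * m * x 0 ^ 2 :=
    le_mul_of_one_le_left (sq_nonneg _) (one_le_mul_of_one_le_of_one_le hN (by linarith))
  have h1 : x 1 ^ 2 ≤ (m + n - 1) * n * x 1 ^ 2 :=
    le_mul_of_one_le_left (sq_nonneg _) (one_le_mul_of_one_le_of_one_le hN (by linarith))
  have h2 : x 2 ^ 2 ≤ m * x 2 ^ 2 := le_mul_of_one_le_left (sq_nonneg _) (by linarith)
  have h3 : x 3 ^ 2 ≤ n * x 3 ^ 2 := le_mul_of_one_le_left (sq_nonneg _) (by linarith)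
  rw [mem_closedBall_zero_iff, pi_norm_le_iff_of_nonneg zero_le_one]
  intro i
  rw [Real.norm_eq_abs, ← sq_le_one_iff_abs_le_one]
  have p0 := sq_nonneg (x 0)
  have p1 := sq_nonneg (x 1)
  have p2 := sq_nonneg (x 2)
  have p3 := sq_nonneg (x 3)
  suffices x 0 ^ 2 ≤ 1 ∧ x 1 ^ 2 ≤ 1 ∧ x 2 ^ 2 ≤ 1 ∧ x 3 ^ 2 ≤ 1 by
    fin_cases i
    exacts [this.1, this.2.1, this.2.2.1, this.2.2.2]
  refine ⟨?_, ?_, ?_, ?_⟩ <;> linarith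

theorem isCompact_closedStateSpace (hm : 1 < m) (hn : 1 < n) :
    IsCompact (closedStateSpace m n (-1) (-1)) :=
  (isCompact_closedBall 0 1).of_isClosed_subset isClosed_closure
    (closedStateSpace_subset_closedBall hm hn)

/-- A trajectory of a scalar multiple of the vector field that starts in the state space stays
there. -/
theorem mem_stateSpace_of_hasDerivAt {kg kh : ℝ} {c : ℝ → ℝ} {x : ℝ → State} (hc : Continuous c)
    (hx : ∀ t, HasDerivAt x (c t • vectorField m n kg kh (x t)) t)
    (h0 : x 0 ∈ stateSpace m n kg kh) (t : ℝ) : x t ∈ stateSpace m n kg kh := by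
  have hcont : Continuous x := continuous_iff_continuousAt.2 fun t => (hx t).continuousAt
  have hi : ∀ i, Continuous fun t => x t i := fun i => (continuous_apply i).comp hcont
  have hσ : Continuous fun t => shearSum m n (x t) := by
    unfold shearSum
    exact (continuous_const.mul ((hi 2).pow 2)).add (continuous_const.mul ((hi 3).pow 2))
  have hd : ∀ i t, HasDerivAt (fun t => x t i) (c t * vectorField m n kg kh (x t) i) t :=
    fun i t => by simpa using (hasDerivAt_pi.1 (hx t)) i
  have d0 := hd 0
  have d1 := hd 1
  have d2 := hd 2
  have d3 := hd 3
  simp only [vectorField, Matrix.cons_val] at d0 d1 d2 d3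
  obtain ⟨hT, hH, hA, hB⟩ := h0
  -- For `c = 1` one has `C₂' = -2 σ C₂` identically, whereas `C₁' = (1 - σ) C₁ - C₂`; hence the
  -- Hamiltonian constraint has to be propagated first.
  have eH : ∀ t, hamiltonianConstraint m n kg kh (x t) = 0 := by
    intro t
    obtain ⟨k, -, hk⟩ := exists_pos_mul_of_hasDerivAt_mul_self
      (y := fun t => hamiltonianConstraint m n kg kh (x t))
      (a := fun t => c t * (-2 * shearSum m n (x t))) (by fun_prop) (fun t => by
        simp only [hamiltonianConstraint, shearSum]
        convert! (((d2 t).pow 2).const_mul (m : ℝ)).add (((d3 t).pow 2).const_mul (n : ℝ)) |>.sub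
          (((((d0 t).pow 2).const_mul (kg * m)).add (((d1 t).pow 2).const_mul (kh * n))).const_mul
            ((m : ℝ) + n - 1)) |>.sub_const 1 using 1
        simp only [shearSum]
        ring) t
    simp only [hk, hH, mul_zero]
  have eT : ∀ t, traceConstraint m n (x t) = 0 := by
    intro t
    obtain ⟨k, -, hk⟩ := exists_pos_mul_of_hasDerivAt_mul_self
      (y := fun t => traceConstraint m n (x t))
      (a := fun t => c t * (1 - shearSum m n (x t))) (by fun_prop) (fun t => by
        have := eH t
        simp only [traceConstraint, hamiltonianConstraint] at this ⊢
        convert! ((d2 t).const_mul (m : ℝ)).add ((d3 t).const_mul (n : ℝ)) |>.sub_const 1 using 1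
        linear_combination c t * this) t
    simp only [hk, hT, mul_zero]
  obtain ⟨k, hk, ek⟩ := exists_pos_mul_of_hasDerivAt_mul_self (y := fun t => x t 0)
    (a := fun t => c t * (x t 2 - shearSum m n (x t))) (by fun_prop)
    (fun t => by convert! d0 t using 1; ring) t
  obtain ⟨l, hl, el⟩ := exists_pos_mul_of_hasDerivAt_mul_self (y := fun t => x t 1)
    (a := fun t => c t * (x t 3 - shearSum m n (x t))) (by fun_prop)
    (fun t => by convert! d1 t using 1; ring) t
  exact ⟨eT t, eH t, ek ▸ mul_pos hk hA, el ▸ mul_pos hl hB⟩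

/-- The system generates a unique complete flow on the closed state space. -/
theorem existsUnique_isSystemFlow (hm : 1 < m) (hn : 1 < n) :
    ∃! φ : Flow ℝ (closedStateSpace m n (-1) (-1)), IsSystemFlow m n (-1) (-1) φ := by
  set f := vectorField m n (-1) (-1)
  -- The inner radius 1 is that of a sup-norm ball containing the closed state space, so the cut-off
  -- leaves the field unchanged there.
  let χ : ContDiffBump (0 : State) := ⟨1, 2, one_pos, one_lt_two⟩
  let g : State → State := fun x => χ x • f x
  have hg : ContDiff ℝ 1 g := χ.contDiff.smul (contDiff_vectorField m n _ _)
  have hgs : HasCompactSupport g := χ.hasCompactSupport.smul_right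
  obtain ⟨C, hC⟩ := hg.lipschitzWith_of_hasCompactSupport hgs one_ne_zero
  obtain ⟨M, hM⟩ := hgs.exists_bound_of_continuous hg.continuous
  have hgf : ∀ x ∈ closedStateSpace m n (-1) (-1), g x = f x := fun x hx => by
    simp only [g, χ.one_of_mem_closedBall (closedStateSpace_subset_closedBall hm hn hx), one_smul]
  obtain ⟨Φ, hΦ⟩ := exists_flow_of_lipschitzWith_of_bounded (M := M.toNNReal) hC
    fun x => (hM x).trans (Real.le_coe_toNNReal M)
  have hS : IsInvariant Φ (closedStateSpace m n (-1) (-1)) := by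
    intro t
    -- Only the state space itself needs to be invariant; continuity of each time map passes this to
    -- the closure. The scalar factor is the cut-off along the trajectory.
    refine MapsTo.closure (fun x hx => ?_) (Φ.continuous_toFun t)
    have hc : Continuous fun s => Φ s x := by fun_prop
    refine mem_stateSpace_of_hasDerivAt (c := fun s => χ (Φ s x)) (x := fun s => Φ s x)
      (χ.continuous.comp hc) (hΦ x) ?_ t
    simpa using hx
  refine ⟨Φ.restrict hS, fun x t => ?_, fun ψ hψ => ?_⟩
  · have := hΦ x t
    rwa [hgf _ (hS t x.2)] at this
  · ext t x : 3
    have := ODE_solution_unique_univ (v := fun _ => g) (s := fun _ => univ) (K := C) (t₀ := 0)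
      (f := fun s => (ψ s x : State)) (g := fun s => Φ s x)
      (fun _ => hC.lipschitzOnWith)
      (fun s => ⟨by rw [hgf _ (ψ s x).2]; exact hψ x s, trivial⟩)
      (fun s => ⟨hΦ x s, trivial⟩) (by simp)
    simpa using congrFun (congrFun this t) _

/-! ### The system in coordinates, and orbits with `P` somewhere negative. -/

/-- The functions `A B P Q` on `X` satisfy the constraints and evolve along the flow `φ` by the
system with `k_g = k_h = -1`; they separate the points of `X`, and take all values that
the constraints and the positivity of `A` and `B` permit. -/
structure IsWarpedFlow (m n : ℕ) {X : Type*} [TopologicalSpace X] (φ : Flow ℝ X)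
    (A B P Q : X → ℝ) : Prop where
  hm : (2 : ℝ) ≤ m
  hn : (2 : ℝ) ≤ n
  contA : Continuous A
  contB : Continuous B
  contP : Continuous P
  contQ : Continuous Q
  derivA : ∀ x t, HasDerivAt (fun s => A (φ s x))
    (A (φ t x) * (P (φ t x) - (m * P (φ t x) ^ 2 + n * Q (φ t x) ^ 2))) t
  derivB : ∀ x t, HasDerivAt (fun s => B (φ s x))
    (B (φ t x) * (Q (φ t x) - (m * P (φ t x) ^ 2 + n * Q (φ t x) ^ 2))) t
  derivP : ∀ x t, HasDerivAt (fun s => P (φ s x))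
    (P (φ t x) * (1 - (m * P (φ t x) ^ 2 + n * Q (φ t x) ^ 2)) - (m + n - 1) * A (φ t x) ^ 2) t
  derivQ : ∀ x t, HasDerivAt (fun s => Q (φ s x))
    (Q (φ t x) * (1 - (m * P (φ t x) ^ 2 + n * Q (φ t x) ^ 2)) - (m + n - 1) * B (φ t x) ^ 2) t
  trace : ∀ x, m * P x + n * Q x = 1
  ham : ∀ x, m * P x ^ 2 + n * Q x ^ 2 + (m + n - 1) * (m * A x ^ 2 + n * B x ^ 2) = 1
  nonnegA : ∀ x, 0 ≤ A x
  nonnegB : ∀ x, 0 ≤ B x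
  inj : ∀ x y, A x = A y → B x = B y → P x = P y → Q x = Q y → x = y
  surj : ∀ a b p q : ℝ, 0 < a → 0 < b → m * p + n * q = 1 →
    m * p ^ 2 + n * q ^ 2 + (m + n - 1) * (m * a ^ 2 + n * b ^ 2) = 1 →
    ∃ x, A x = a ∧ B x = b ∧ P x = p ∧ Q x = q

namespace IsWarpedFlow

variable {m n : ℕ} {X : Type*} [TopologicalSpace X] {φ : Flow ℝ X} {A B P Q : X → ℝ} {x y : X}

/-- Exchanging the two factors of the warped product. -/
theorem symm (h : IsWarpedFlow m n φ A B P Q) : IsWarpedFlow n m φ B A Q P where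
  hm := h.hn
  hn := h.hm
  contA := h.contB
  contB := h.contA
  contP := h.contQ
  contQ := h.contP
  derivA x t := by convert! h.derivB x t using 1; ring
  derivB x t := by convert! h.derivA x t using 1; ring
  derivP x t := by convert! h.derivQ x t using 1; ring
  derivQ x t := by convert! h.derivP x t using 1; ring
  trace x := by linarith [h.trace x]
  ham x := by linarith [h.ham x]
  nonnegA := h.nonnegB
  nonnegB := h.nonnegA
  inj x y hB hA hQ hP := h.inj x y hA hB hP hQ
  surj a b p q ha hb h1 h2 := by
    obtain ⟨x, h1, h2, h3, h4⟩ := h.surj b a q p hb ha (by linarith) (by linarith)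
    exact ⟨x, h2, h1, h4, h3⟩

theorem continuous_flow_left (φ : Flow ℝ X) (x : X) : Continuous fun t => φ t x :=
  φ.continuous continuous_id continuous_const

theorem continuous_sigma_comp (h : IsWarpedFlow m n φ A B P Q) (x : X) :
    Continuous fun t => m * P (φ t x) ^ 2 + n * Q (φ t x) ^ 2 := by
  have hP := h.contP.comp (continuous_flow_left φ x)
  have hQ := h.contQ.comp (continuous_flow_left φ x)
  exact (continuous_const.mul (hP.pow 2)).add (continuous_const.mul (hQ.pow 2))

theorem exists_pos_mul_A (h : IsWarpedFlow m n φ A B P Q) (x : X) (t : ℝ) :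
    ∃ c, 0 < c ∧ A (φ t x) = c * A x := by
  have := exists_pos_mul_of_hasDerivAt_mul_self (y := fun t => A (φ t x))
    (a := fun t => P (φ t x) - (m * P (φ t x) ^ 2 + n * Q (φ t x) ^ 2))
    ((h.contP.comp (continuous_flow_left φ x)).sub (h.continuous_sigma_comp x))
    (fun t => by convert! h.derivA x t using 1; ring) t
  simpa using this

theorem A_flow_pos (h : IsWarpedFlow m n φ A B P Q) (hA : A x ≠ 0) (t : ℝ) : 0 < A (φ t x) := by
  obtain ⟨c, hc, e⟩ := h.exists_pos_mul_A x t
  exact e ▸ mul_pos hc ((h.nonnegA x).lt_of_ne' hA)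

theorem A_flow_eq_zero (h : IsWarpedFlow m n φ A B P Q) (hA : A x = 0) (t : ℝ) :
    A (φ t x) = 0 := by
  obtain ⟨c, hc, e⟩ := h.exists_pos_mul_A x t
  rw [e, hA, mul_zero]

theorem B_flow_pos (h : IsWarpedFlow m n φ A B P Q) (hB : B x ≠ 0) (t : ℝ) : 0 < B (φ t x) :=
  h.symm.A_flow_pos hB t

theorem one_sub_sigma_nonneg (h : IsWarpedFlow m n φ A B P Q) (x : X) :
    0 ≤ 1 - (m * P x ^ 2 + n * Q x ^ 2) := by
  have hm := h.hm
  have hn := h.hn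
  have : 0 ≤ ((m : ℝ) + n - 1) * (m * A x ^ 2 + n * B x ^ 2) :=
    mul_nonneg (by linarith) (by positivity)
  linarith [h.ham x]

/-- The points with `σ = 1` have `A = B = 0`. -/
theorem eq_zero_of_sigma_eq_one (h : IsWarpedFlow m n φ A B P Q)
    (hσ : m * P x ^ 2 + n * Q x ^ 2 = 1) : A x = 0 ∧ B x = 0 := by
  have hm := h.hm
  have hn := h.hn
  have h1 : ((m : ℝ) + n - 1) * (m * A x ^ 2 + n * B x ^ 2) = 0 := by linarith [h.ham x]
  have h2 : (m : ℝ) * A x ^ 2 + n * B x ^ 2 = 0 :=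
    (mul_eq_zero.1 h1).resolve_left (by linarith)
  have pA : 0 ≤ (m : ℝ) * A x ^ 2 := by positivity
  have pB : 0 ≤ (n : ℝ) * B x ^ 2 := by positivity
  have hA : (m : ℝ) * A x ^ 2 = 0 := by linarith
  have hB : (n : ℝ) * B x ^ 2 = 0 := by linarith
  have hA' := (mul_eq_zero.1 hA).resolve_left (by linarith)
  have hB' := (mul_eq_zero.1 hB).resolve_left (by linarith)
  exact ⟨pow_eq_zero_iff (two_ne_zero) |>.1 hA', pow_eq_zero_iff (two_ne_zero) |>.1 hB'⟩

theorem neg_one_le_P (h : IsWarpedFlow m n φ A B P Q) (x : X) : -1 ≤ P x ∧ P x ≤ 1 := by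
  have hm := h.hm
  have hn := h.hn
  have h1 := h.one_sub_sigma_nonneg x
  have h2 : P x ^ 2 ≤ m * P x ^ 2 := le_mul_of_one_le_left (sq_nonneg _) (by linarith)
  have h3 : 0 ≤ (n : ℝ) * Q x ^ 2 := by positivity
  exact abs_le.1 ((sq_le_one_iff_abs_le_one _).1 (by linarith))

/-- At points with `A = B = 0` exactly one of `P`, `Q` is negative. -/
theorem P_neg_or_Q_neg (h : IsWarpedFlow m n φ A B P Q) (hA : A x = 0) (hB : B x = 0) :
    P x < 0 ∨ Q x < 0 := by
  by_contra! hPQ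
  have hm := h.hm
  have hn := h.hn
  have h1 := h.trace x
  have h2 := h.ham x
  rw [hA, hB] at h2
  -- As `m P ≤ 1` and `n Q ≤ 1`, the condition `σ = 1` would give `P + Q ≥ 1`, while `m, n ≥ 2` and
  -- the trace constraint give `P + Q ≤ 1 / 2`.
  have hP : (m : ℝ) * P x ^ 2 ≤ P x := by nlinarith [mul_nonneg (by linarith : (0 : ℝ) ≤ n) hPQ.2]
  have hQ : (n : ℝ) * Q x ^ 2 ≤ Q x := by nlinarith [mul_nonneg (by linarith : (0 : ℝ) ≤ m) hPQ.1]
  have hP2 : 2 * P x ≤ m * P x := mul_le_mul_of_nonneg_right hm hPQ.1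
  have hQ2 : 2 * Q x ≤ n * Q x := mul_le_mul_of_nonneg_right hn hPQ.2
  linarith

theorem P_flow_le (h : IsWarpedFlow m n φ A B P Q) (x : X) {s t : ℝ} (hst : s ≤ t) :
    ∃ c, 0 < c ∧ P (φ t x) ≤ c * P (φ s x) := by
  have hm := h.hm
  have hn := h.hn
  exact exists_pos_le_mul_of_hasDerivAt (y := fun t => P (φ t x))
    (a := fun t => 1 - (m * P (φ t x) ^ 2 + n * Q (φ t x) ^ 2))
    (b := fun t => ((m : ℝ) + n - 1) * A (φ t x) ^ 2)
    (continuous_const.sub (h.continuous_sigma_comp x))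
    (fun t => mul_nonneg (by linarith) (sq_nonneg _))
    (fun t => by convert! h.derivP x t using 1; ring) hst

theorem P_flow_neg (h : IsWarpedFlow m n φ A B P Q) {s t : ℝ} (hst : s ≤ t)
    (hP : P (φ s x) < 0) : P (φ t x) < 0 := by
  obtain ⟨c, hc, e⟩ := h.P_flow_le x hst
  exact e.trans_lt (mul_neg_of_pos_of_neg hc hP)

/-- Once `P` is negative, the orbit tends to the equilibrium with `A = B = 0` and `P < 0`. -/
theorem omegaLimit_of_P_neg (h : IsWarpedFlow m n φ A B P Q) {s : ℝ} (hP : P (φ s x) < 0) :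
    ∀ y ∈ ω⁺ φ {x}, A y = 0 ∧ B y = 0 ∧ P y < 0 := by
  have hm := h.hm
  have hn := h.hn
  have hanti : AntitoneOn (fun t => P (φ t x)) (Ici s) := by
    refine antitoneOn_of_hasDerivWithinAt_nonpos (convex_Ici s)
      (h.contP.comp (continuous_flow_left φ x)).continuousOn
      (fun t _ => (h.derivP x t).hasDerivWithinAt) fun t ht => ?_
    rw [interior_Ici, mem_Ioi] at ht
    have h1 := mul_nonneg (neg_nonneg.2 (h.P_flow_neg ht.le hP).le)
      (h.one_sub_sigma_nonneg (φ t x))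
    have h2 : 0 ≤ ((m : ℝ) + n - 1) * A (φ t x) ^ 2 := mul_nonneg (by linarith) (sq_nonneg _)
    linarith
  obtain ⟨c, hcs, hc⟩ := hanti.exists_tendsto_atTop fun t => (h.neg_one_le_P (φ t x)).1
  intro y hy
  have hPy : P y = c := Flow.eq_of_mem_omegaLimit_of_tendsto h.contP hc hy
  have hPneg : P y < 0 := hPy ▸ hcs.trans_lt hP
  -- Both terms of `P'` are nonpositive when `P < 0`, so its vanishing on the limit set forces `σ =
  -- 1`.
  have hd := Flow.hasDerivAt_eq_zero_of_mem_omegaLimit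
    (fun t => tendsto_atTop_add_const_left _ t tendsto_id) h.contP hc hy (h.derivP y 0)
  simp only [Flow.map_zero, id] at hd
  have h1 := mul_nonneg (neg_nonneg.2 hPneg.le) (h.one_sub_sigma_nonneg y)
  have h2 : 0 ≤ ((m : ℝ) + n - 1) * A y ^ 2 := mul_nonneg (by linarith) (sq_nonneg _)
  have h3 : P y * (1 - (m * P y ^ 2 + n * Q y ^ 2)) = 0 := by linarith
  have h4 := (mul_eq_zero.1 h3).resolve_left hPneg.ne
  obtain ⟨hA, hB⟩ := h.eq_zero_of_sigma_eq_one (x := y) (by linarith)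
  exact ⟨hA, hB, hPneg⟩

end IsWarpedFlow

/-! ### Orbits on the boundary `A = 0`. -/

theorem le_quadratic_of_sq_le {α β γ p q : ℝ} (hα : 0 < α) (hγ : 0 < γ)
    (hp : α * p ^ 2 - β * p = γ) (hpq : 0 ≤ p * q) (hsq : p ^ 2 ≤ q ^ 2) :
    γ ≤ α * q ^ 2 - β * q := by
  -- The quadratic is convex and vanishes at 0, so beyond a point where it is positive it increases
  -- away from 0. The negative side reduces to this by reflection.
  have key : ∀ b r s : ℝ, 0 ≤ r → 0 ≤ s → r ^ 2 ≤ s ^ 2 → α * r ^ 2 - b * r = γ →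
      γ ≤ α * s ^ 2 - b * s := by
    intro b r s hr hs hrs he
    have hle : r ≤ s := (sq_le_sq₀ hr hs).1 hrs
    have hr' : 0 < r := hr.lt_of_ne fun h0 => by
      rw [← h0] at he
      norm_num at he
      linarith
    have h1 : 0 < α * r - b := by
      have : 0 < (α * r - b) * r := by linarith [he]
      exact pos_of_mul_pos_left this hr
    nlinarith [mul_nonneg h1.le (sub_nonneg.2 hle),
      mul_nonneg (mul_nonneg hα.le (sub_nonneg.2 hle)) hs]
  rcases le_total 0 p with h | h
  · rcases h.eq_or_lt with h | h
    · rw [← h] at hp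
      norm_num at hp
      linarith
    · exact key β p q h.le (nonneg_of_mul_nonneg_right hpq h) hsq hp
  · rcases h.eq_or_lt with h | h
    · rw [h] at hp
      norm_num at hp
      linarith
    · have := key (-β) (-p) (-q) (by linarith)
        (nonneg_of_mul_nonneg_right (by linarith : 0 ≤ (-p) * (-q)) (by linarith)) (by linarith)
        (by linarith)
      linarith

namespace IsWarpedFlow

variable {m n : ℕ} {X : Type*} [TopologicalSpace X] {φ : Flow ℝ X} {A B P Q : X → ℝ} {x y : X}

theorem monotone_P_sq (h : IsWarpedFlow m n φ A B P Q) (hA : A x = 0) :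
    Monotone fun t => P (φ t x) ^ 2 :=
  monotone_of_hasDerivAt_nonneg (fun t => (h.derivP x t).pow 2) fun t => by
    rw [h.A_flow_eq_zero hA]
    have := mul_nonneg (sq_nonneg (P (φ t x))) (h.one_sub_sigma_nonneg (φ t x))
    simp only [Pi.zero_apply, Nat.cast_ofNat, Nat.add_one_sub_one, pow_one]
    linarith

/-- Along orbits in the boundary `A = 0` the sign of `P` does not change. -/
theorem P_mul_P_flow_nonneg (h : IsWarpedFlow m n φ A B P Q) (hA : A x = 0) (t : ℝ) :
    0 ≤ P x * P (φ t x) ∧ (P x ≠ 0 → P (φ t x) ≠ 0) := by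
  obtain ⟨c, hc, e⟩ := exists_pos_mul_of_hasDerivAt_mul_self (y := fun t => P (φ t x))
    (a := fun t => 1 - (m * P (φ t x) ^ 2 + n * Q (φ t x) ^ 2))
    (continuous_const.sub (h.continuous_sigma_comp x))
    (fun t => by
      convert! h.derivP x t using 1
      rw [h.A_flow_eq_zero hA]
      ring) t
  simp only [Flow.map_zero, id] at e
  rw [e]
  exact ⟨by nlinarith [mul_nonneg hc.le (sq_nonneg (P x))], fun hP => mul_ne_zero hc.ne' hP⟩

/-- LaSalle for `P²`, whose derivative on `A = 0` is `2 P² (1 - σ)`: either `P` vanishes or `σ = 1`.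
The sign of `P` survives in the limit, which later tells `F1` from `F2`. -/
theorem eq_zero_or_of_mem_omegaLimit (h : IsWarpedFlow m n φ A B P Q) {f : Filter ℝ} {c : ℝ}
    (hf : ∀ t, Tendsto (t + ·) f f) (hA : A x = 0)
    (hc : Tendsto (fun t => P (φ t x) ^ 2) f (𝓝 c)) (hy : y ∈ ω f φ {x}) :
    A y = 0 ∧ P y ^ 2 = c ∧ 0 ≤ P x * P y ∧ (P y = 0 ∨ B y = 0) := by
  have hAy : A y = 0 := Flow.omegaLimit_subset_of_isClosed (C := {y | A y = 0})
    (isClosed_eq h.contA continuous_const)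
    (Eventually.of_forall fun t => h.A_flow_eq_zero hA t) hy
  have hPy : 0 ≤ P x * P y := Flow.omegaLimit_subset_of_isClosed (C := {y | 0 ≤ P x * P y})
    (isClosed_le continuous_const (continuous_const.mul h.contP))
    (Eventually.of_forall fun t => (h.P_mul_P_flow_nonneg hA t).1) hy
  refine ⟨hAy, Flow.eq_of_mem_omegaLimit_of_tendsto (W := fun y => P y ^ 2)
    (h.contP.pow 2) hc hy, hPy, ?_⟩
  have hd := Flow.hasDerivAt_eq_zero_of_mem_omegaLimit hf (W := fun y => P y ^ 2)
    (h.contP.pow 2) hc hy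
    ((h.derivP y 0).pow 2)
  simp only [Flow.map_zero, id, hAy] at hd
  have h3 : P y ^ 2 * (1 - (m * P y ^ 2 + n * Q y ^ 2)) = 0 := by
    simp only [Nat.cast_ofNat, Nat.add_one_sub_one, pow_one] at hd
    linear_combination hd / 2
  rcases mul_eq_zero.1 h3 with h4 | h4
  · exact Or.inl (pow_eq_zero_iff two_ne_zero |>.1 h4)
  · exact Or.inr (h.eq_zero_of_sigma_eq_one (x := y) (by linarith)).2

/-- Orbits in the boundary `A = 0` other than the equilibrium `P = 0` end at the equilibria with
`A = B = 0`. -/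
theorem omegaLimit_of_A_eq_zero (h : IsWarpedFlow m n φ A B P Q) (hA : A x = 0) (hP : P x ≠ 0) :
    (∀ y ∈ ω⁺ φ {x}, A y = 0 ∧ B y = 0 ∧ P y < 0) ∨
      (∀ y ∈ ω⁺ φ {x}, A y = 0 ∧ B y = 0 ∧ Q y < 0) := by
  rcases lt_or_gt_of_ne hP with hP | hP
  · exact Or.inl (h.omegaLimit_of_P_neg (s := 0) (by simpa using hP))
  right
  intro y hy
  have hmono := h.monotone_P_sq hA
  have hbdd : ∀ t, P (φ t x) ^ 2 ≤ 1 := fun t => by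
    rw [sq_le_one_iff_abs_le_one, abs_le]
    exact h.neg_one_le_P _
  have hlim := tendsto_atTop_ciSup hmono ⟨1, by rintro _ ⟨t, rfl⟩; exact hbdd t⟩
  have hle := hmono.ge_of_tendsto hlim 0
  obtain ⟨hAy, hPy, hPPy, hor⟩ := h.eq_zero_or_of_mem_omegaLimit
    (fun t => tendsto_atTop_add_const_left _ t tendsto_id) hA hlim hy
  rw [← hPy] at hle
  simp only [Flow.map_zero, id] at hle
  have hPy0 : P y ≠ 0 := fun h0 => by
    rw [h0] at hle
    nlinarith
  have hBy := hor.resolve_left hPy0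
  refine ⟨hAy, hBy, (h.P_neg_or_Q_neg hAy hBy).resolve_left fun hneg => ?_⟩
  nlinarith

/-- Orbits in the boundary `A = 0` with `B ≠ 0` start at the equilibrium with `P = 0`. -/
theorem alphaLimit_of_A_eq_zero (h : IsWarpedFlow m n φ A B P Q) (hA : A x = 0) (hB : B x ≠ 0) :
    ∀ y ∈ ω⁻ φ {x}, A y = 0 ∧ P y = 0 := by
  intro y hy
  have hm := h.hm
  have hn := h.hn
  have hmono := h.monotone_P_sq hA
  have hlim := tendsto_atBot_ciInf hmono ⟨0, by rintro _ ⟨t, rfl⟩; exact sq_nonneg _⟩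
  have hle := hmono.le_of_tendsto hlim 0
  obtain ⟨hAy, hPy, hPPy, hor⟩ := h.eq_zero_or_of_mem_omegaLimit
    (fun t => tendsto_atBot_add_const_left _ t tendsto_id) hA hlim hy
  rw [← hPy] at hle
  simp only [Flow.map_zero, id] at hle
  refine ⟨hAy, hor.resolve_right fun hBy => ?_⟩
  -- Elimination of `Q` from the constraints. A limit point with `B = 0` gives the quadratic its
  -- largest value `n - 1` at some `P` no farther from 0 than `P x`, so `x` would attain it too,
  -- contrary to `B x ≠ 0`.
  have quad : ∀ z, A z = 0 → ((m : ℝ) * n + m ^ 2) * P z ^ 2 - 2 * m * P z =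
      n - 1 - n * (m + n - 1) * (n * B z ^ 2) := by
    intro z hAz
    have h1 := h.trace z
    have h2 := h.ham z
    rw [hAz] at h2
    have h3 : (n : ℝ) * Q z = 1 - m * P z := by linarith
    linear_combination n * h2 - (n * Q z + 1 - m * P z) * h3
  have e1 := quad y hAy
  rw [hBy] at e1
  have := le_quadratic_of_sq_le (α := (m : ℝ) * n + m ^ 2) (β := 2 * m) (γ := n - 1)
    (by positivity) (by linarith) (by linarith)
    (by linarith [mul_comm (P x) (P y)] : 0 ≤ P y * P x) hle
  rw [quad x hA] at this
  have hpos : 0 < (n : ℝ) * (m + n - 1) * (n * B x ^ 2) := by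
    have : (0 : ℝ) < m + n - 1 := by linarith
    positivity
  linarith

/-! ### Orbits with `A B ≠ 0`. -/

/-- The monotone function `A ^ m * B ^ n`. -/
theorem hasDerivAt_pow_mul_pow (h : IsWarpedFlow m n φ A B P Q) (x : X) (t : ℝ) :
    HasDerivAt (fun t => A (φ t x) ^ m * B (φ t x) ^ n)
      (-(m * n * (P (φ t x) - Q (φ t x)) ^ 2 * (A (φ t x) ^ m * B (φ t x) ^ n))) t := by
  have hm : m ≠ 0 := fun h0 => by have := h.hm; rw [h0] at this; norm_num at this
  have hn : n ≠ 0 := fun h0 => by have := h.hn; rw [h0] at this; norm_num at this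
  convert! ((h.derivA x t).pow m).mul ((h.derivB x t).pow n) using 1
  have h1 := h.trace (φ t x)
  set a := A (φ t x)
  set b := B (φ t x)
  set p := P (φ t x)
  set q := Q (φ t x)
  have ea : a ^ (m - 1) * a = a ^ m := pow_sub_one_mul hm a
  have eb : b ^ (n - 1) * b = b ^ n := pow_sub_one_mul hn b
  simp only [Pi.pow_apply]
  rw [← ea, ← eb]
  linear_combination (m * p + n * q) * (a ^ (m - 1) * a * b ^ (n - 1) * b) * h1

theorem antitone_pow_mul_pow (h : IsWarpedFlow m n φ A B P Q) (x : X) :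
    Antitone fun t => A (φ t x) ^ m * B (φ t x) ^ n :=
  antitone_of_hasDerivAt_nonpos (h.hasDerivAt_pow_mul_pow x) fun t => by
    have hA := h.nonnegA (φ t x)
    have hB := h.nonnegB (φ t x)
    simp only [Pi.zero_apply, Left.neg_nonpos_iff]
    positivity

/-- A point with `A B ≠ 0` along whose orbit `A ^ m * B ^ n` is constant is the equilibrium
`A = B = P = Q = 1 / (m + n)`. -/
theorem eq_of_pow_mul_pow_const (h : IsWarpedFlow m n φ A B P Q) (hA : A y ≠ 0) (hB : B y ≠ 0)
    {c : ℝ} (hc : ∀ t, A (φ t y) ^ m * B (φ t y) ^ n = c) :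
    A y = 1 / (m + n) ∧ B y = 1 / (m + n) ∧ P y = 1 / (m + n) ∧ Q y = 1 / (m + n) := by
  have hm := h.hm
  have hn := h.hn
  have hPQ : ∀ t, P (φ t y) - Q (φ t y) = 0 := by
    intro t
    have hd := h.hasDerivAt_pow_mul_pow y t
    rw [funext hc] at hd
    have h0 := hd.unique (hasDerivAt_const t c)
    have hA' := (h.A_flow_pos hA t).ne'
    have hB' := (h.B_flow_pos hB t).ne'
    have hm' : (m : ℝ) ≠ 0 := by positivity
    have hn' : (n : ℝ) ≠ 0 := by positivity
    rw [neg_eq_zero, mul_eq_zero, mul_eq_zero] at h0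
    rcases h0 with (h0 | h0) | h0
    · exact absurd h0 (mul_ne_zero hm' hn')
    · exact pow_eq_zero_iff two_ne_zero |>.1 h0
    · exact absurd h0 (by positivity)
  -- Since `P = Q` for all time, the derivative of `P - Q` vanishes as well, which gives `A² = B²`;
  -- the constraints fix the rest.
  have hd := (h.derivP y 0).sub (h.derivQ y 0)
  have h1 := hPQ 0
  have e1 : ((fun s => P (φ s y)) - fun s => Q (φ s y)) = fun _ => 0 := funext hPQ
  rw [e1] at hd
  have h2 := hd.unique (hasDerivAt_const 0 0)
  simp only [Flow.map_zero, id] at h1 h2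
  have hPQy : Q y = P y := by linarith
  have hP : P y = 1 / (m + n) := by
    have := h.trace y
    rw [hPQy] at this
    rw [eq_div_iff (by positivity)]
    linarith
  rw [hPQy] at h2
  have hN : (0 : ℝ) < m + n - 1 := by linarith
  have hAB : A y ^ 2 = B y ^ 2 := mul_left_cancel₀ hN.ne' (by linarith)
  have hAB' : B y = A y := ((sq_eq_sq₀ (h.nonnegA y) (h.nonnegB y)).1 hAB).symm
  have hA2 : A y ^ 2 = (1 / (m + n)) ^ 2 := by
    have h3 := h.ham y
    rw [hAB', hPQy, hP] at h3
    have hmn : ((m : ℝ) + n) ≠ 0 := by positivity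
    have h4 : ((m : ℝ) + n - 1) * (m + n) * (A y ^ 2 - (1 / (m + n)) ^ 2) = 0 := by
      field_simp at h3 ⊢
      linarith
    have := (mul_eq_zero.1 h4).resolve_left (by positivity)
    linarith
  have hAe : A y = 1 / (m + n) := (sq_eq_sq₀ (h.nonnegA y) (by positivity)).1 hA2
  exact ⟨hAe, hAB'.trans hAe, hP, hPQy.trans hP⟩

theorem eq_of_mem_omegaLimit_of_pow_mul_pow (h : IsWarpedFlow m n φ A B P Q) {f : Filter ℝ} {c : ℝ}
    (hf : ∀ t, Tendsto (t + ·) f f) (hc0 : c ≠ 0)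
    (hc : Tendsto (fun t => A (φ t x) ^ m * B (φ t x) ^ n) f (𝓝 c)) (hy : y ∈ ω f φ {x}) :
    A y = 1 / (m + n) ∧ B y = 1 / (m + n) ∧ P y = 1 / (m + n) ∧ Q y = 1 / (m + n) := by
  have hm : m ≠ 0 := fun h0 => by have := h.hm; rw [h0] at this; norm_num at this
  have hn : n ≠ 0 := fun h0 => by have := h.hn; rw [h0] at this; norm_num at this
  have key : ∀ t, A (φ t y) ^ m * B (φ t y) ^ n = c := fun t =>
    Flow.eq_of_mem_omegaLimit_of_tendsto (W := fun z => A z ^ m * B z ^ n)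
      ((h.contA.pow m).mul (h.contB.pow n)) hc (Flow.map_mem_omegaLimit hf hy t)
  have h0 := key 0
  simp only [Flow.map_zero, id] at h0
  refine h.eq_of_pow_mul_pow_const (fun hA => hc0 ?_) (fun hB => hc0 ?_) key
  · rw [← h0, hA, zero_pow hm, zero_mul]
  · rw [← h0, hB, zero_pow hn, mul_zero]

variable [CompactSpace X]

theorem exists_tendsto_pow_mul_pow (h : IsWarpedFlow m n φ A B P Q) (x : X) :
    ∃ c, A x ^ m * B x ^ n ≤ c ∧
      Tendsto (fun t => A (φ t x) ^ m * B (φ t x) ^ n) atBot (𝓝 c) := by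
  have hbdd : BddAbove (range fun t => A (φ t x) ^ m * B (φ t x) ^ n) := by
    obtain ⟨M, hM⟩ := (isCompact_range ((h.contA.pow m).mul (h.contB.pow n))).bddAbove
    exact ⟨M, by rintro _ ⟨t, rfl⟩; exact hM ⟨φ t x, rfl⟩⟩
  have hlim := tendsto_atBot_ciSup (h.antitone_pow_mul_pow x) hbdd
  exact ⟨_, by simpa using (h.antitone_pow_mul_pow x).ge_of_tendsto hlim 0, hlim⟩

/-- Backwards in time `A ^ m * B ^ n` does not decrease, so its limit is positive and LaSalle leaves
only `F_*`. -/
theorem alphaLimit_of_ne_zero (h : IsWarpedFlow m n φ A B P Q) (hA : A x ≠ 0) (hB : B x ≠ 0) :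
    ∀ y ∈ ω⁻ φ {x},
      A y = 1 / (m + n) ∧ B y = 1 / (m + n) ∧ P y = 1 / (m + n) ∧ Q y = 1 / (m + n) := by
  intro y hy
  obtain ⟨c, hxc, hc⟩ := h.exists_tendsto_pow_mul_pow x
  have hA' := (h.nonnegA x).lt_of_ne' hA
  have hB' := (h.nonnegB x).lt_of_ne' hB
  have : 0 < A x ^ m * B x ^ n := by positivity
  exact h.eq_of_mem_omegaLimit_of_pow_mul_pow
    (fun t => tendsto_atBot_add_const_left _ t tendsto_id) (by linarith) hc hy

/-- The `ω`-limit sets of the nonstationary orbits with `A B ≠ 0` lie in the boundary. -/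
theorem omegaLimit_subset_boundary (h : IsWarpedFlow m n φ A B P Q) (hA : A x ≠ 0) (hB : B x ≠ 0)
    (hx : ¬ (A x = 1 / (m + n) ∧ B x = 1 / (m + n) ∧ P x = 1 / (m + n) ∧ Q x = 1 / (m + n))) :
    ∀ y ∈ ω⁺ φ {x}, A y = 0 ∨ B y = 0 := by
  intro y hy
  have hanti := h.antitone_pow_mul_pow x
  obtain ⟨d, -, hd⟩ := h.exists_tendsto_pow_mul_pow x
  obtain ⟨c, -, hc⟩ := (hanti.antitoneOn (Ici 0)).exists_tendsto_atTop (b := 0) fun t =>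
    mul_nonneg (pow_nonneg (h.nonnegA _) m) (pow_nonneg (h.nonnegB _) n)
  have hV : Continuous fun z => A z ^ m * B z ^ n := (h.contA.pow m).mul (h.contB.pow n)
  have hf : ∀ t : ℝ, Tendsto (t + ·) atTop atTop := fun t =>
    tendsto_atTop_add_const_left _ t tendsto_id
  by_cases hc0 : c = 0
  · have := Flow.eq_of_mem_omegaLimit_of_tendsto hV hc hy
    rw [hc0] at this
    rcases mul_eq_zero.1 this with h1 | h1
    · exact Or.inl (eq_zero_of_pow_eq_zero h1)
    · exact Or.inr (eq_zero_of_pow_eq_zero h1)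
  · exfalso
    -- With a nonzero limit both ends of the orbit accumulate at `F_*`, so the monotone function has
    -- equal limits at both ends, is constant, and the orbit is `F_*` itself.
    obtain ⟨z, hz⟩ := nonempty_omegaLimit atBot φ {x} (singleton_nonempty x)
    have hy' := h.eq_of_mem_omegaLimit_of_pow_mul_pow hf hc0 hc hy
    have hz' := h.alphaLimit_of_ne_zero hA hB z hz
    have ey := Flow.eq_of_mem_omegaLimit_of_tendsto hV hc hy
    have ez := Flow.eq_of_mem_omegaLimit_of_tendsto hV hd hz
    simp only [hy', hz'] at ey ez
    have hcd : d = c := ez.symm.trans ey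
    rw [hcd] at hd
    exact hx (h.eq_of_pow_mul_pow_const hA hB fun t =>
      le_antisymm (hanti.ge_of_tendsto hd t) (hanti.le_of_tendsto hc t))

/-- If `P` and `Q` stay nonnegative, the `ω`-limit set consists of boundary equilibria with `P = 0`
or `Q = 0`. -/
theorem omegaLimit_of_nonneg (h : IsWarpedFlow m n φ A B P Q) (hA : A x ≠ 0) (hB : B x ≠ 0)
    (hx : ¬ (A x = 1 / (m + n) ∧ B x = 1 / (m + n) ∧ P x = 1 / (m + n) ∧ Q x = 1 / (m + n)))
    (hP : ∀ t, 0 ≤ P (φ t x)) (hQ : ∀ t, 0 ≤ Q (φ t x)) :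
    ∀ y ∈ ω⁺ φ {x}, (A y = 0 ∧ P y = 0) ∨ (B y = 0 ∧ Q y = 0) := by
  have hf : ∀ t : ℝ, Tendsto (t + ·) atTop atTop := fun t =>
    tendsto_atTop_add_const_left _ t tendsto_id
  have hP' : ∀ y ∈ ω⁺ φ {x}, 0 ≤ P y := fun y hy =>
    Flow.omegaLimit_subset_of_isClosed (C := {y | 0 ≤ P y})
      (isClosed_le continuous_const h.contP) (Eventually.of_forall hP) hy
  have hQ' : ∀ y ∈ ω⁺ φ {x}, 0 ≤ Q y := fun y hy =>
    Flow.omegaLimit_subset_of_isClosed (C := {y | 0 ≤ Q y})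
      (isClosed_le continuous_const h.contQ) (Eventually.of_forall hQ) hy
  have hne : ∀ z ∈ ω⁺ φ {x}, A z = 0 → B z = 0 → False := fun z hz hAz hBz => by
    rcases h.P_neg_or_Q_neg hAz hBz with h1 | h1
    · exact absurd h1 (hP' z hz).not_gt
    · exact absurd h1 (hQ' z hz).not_gt
  intro y hy
  -- A boundary point other than `F_A`, `F_B` would carry its own `ω`-limit, at `F1` or `F2`, into
  -- that of `x`; but there `P` or `Q` is negative.
  obtain ⟨z, hz⟩ := nonempty_omegaLimit atTop φ {y} (singleton_nonempty y)
  have hzx := Flow.omegaLimit_subset_omegaLimit hf hy hz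
  rcases h.omegaLimit_subset_boundary hA hB hx y hy with h1 | h1
  · refine Or.inl ⟨h1, by_contra fun hPy => ?_⟩
    rcases h.omegaLimit_of_A_eq_zero h1 hPy with h2 | h2
    · exact hne z hzx (h2 z hz).1 (h2 z hz).2.1
    · exact hne z hzx (h2 z hz).1 (h2 z hz).2.1
  · refine Or.inr ⟨h1, by_contra fun hQy => ?_⟩
    rcases h.symm.omegaLimit_of_A_eq_zero h1 hQy with h2 | h2
    · exact hne z hzx (h2 z hz).2.1 (h2 z hz).1
    · exact hne z hzx (h2 z hz).2.1 (h2 z hz).1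

/-- A nonstationary orbit with `A B ≠ 0` converges to one of the boundary equilibria. -/
theorem omegaLimit_cases (h : IsWarpedFlow m n φ A B P Q) (hA : A x ≠ 0) (hB : B x ≠ 0)
    (hx : ¬ (A x = 1 / (m + n) ∧ B x = 1 / (m + n) ∧ P x = 1 / (m + n) ∧ Q x = 1 / (m + n))) :
    (∃ t, P (φ t x) < 0) ∨ (∃ t, Q (φ t x) < 0) ∨
      (∀ y ∈ ω⁺ φ {x}, A y = 0 ∧ P y = 0) ∨ (∀ y ∈ ω⁺ φ {x}, B y = 0 ∧ Q y = 0) := by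
  by_cases hP : ∃ t, P (φ t x) < 0
  · exact Or.inl hP
  by_cases hQ : ∃ t, Q (φ t x) < 0
  · exact Or.inr (Or.inl hQ)
  push Not at hP hQ
  have key := h.omegaLimit_of_nonneg hA hB hx hP hQ
  have hm := h.hm
  have hPQ : ∀ y, Q y = 0 → P y = 1 / m := fun y hy => by
    have := h.trace y
    rw [hy] at this
    rw [eq_div_iff (by positivity)]
    linarith
  have hm2 : (0 : ℝ) < 1 / m := by positivity
  -- `P` is 0 at `F_A` and `1 / m` at `F_B`. The orbit eventually avoids the midway value, so by the
  -- intermediate value theorem it stays on one side.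
  have hev : ∀ᶠ t in atTop, P (φ t x) ≠ 1 / m / 2 := by
    filter_upwards [eventually_mapsTo_of_isOpen_of_omegaLimit_subset atTop φ {x}
      (v := {y | P y ≠ 1 / m / 2}) (isOpen_ne_fun h.contP continuous_const) fun y hy => by
        rcases key y hy with h1 | h1
        · rw [mem_ofPred_eq, h1.2]
          exact (half_pos hm2).ne
        · rw [mem_ofPred_eq, hPQ y h1.2]
          exact (half_lt_self hm2).ne'] with t ht
    exact ht rfl
  obtain ⟨T, hT⟩ := eventually_atTop.1 hev
  have hcont : ContinuousOn (fun t => P (φ t x)) (Ici T) :=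
    (h.contP.comp (continuous_flow_left φ x)).continuousOn
  right
  right
  rcases lt_or_ge (P (φ T x)) (1 / m / 2) with hlt | hge
  · left
    intro y hy
    have hle : P y ≤ 1 / m / 2 := by
      refine Flow.omegaLimit_subset_of_isClosed (C := {y | P y ≤ 1 / m / 2})
        (isClosed_le h.contP continuous_const) ?_ hy
      filter_upwards [eventually_ge_atTop T] with t ht
      by_contra hcon
      obtain ⟨s, hs, hes⟩ := isPreconnected_Ici.intermediate_value self_mem_Ici
        (mem_Ici.2 ht) hcont ⟨hlt.le, (not_le.1 hcon).le⟩
      exact hT s hs hes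
    refine (key y hy).resolve_right fun h1 => ?_
    rw [hPQ y h1.2] at hle
    linarith
  · right
    intro y hy
    have hle : 1 / m / 2 ≤ P y := by
      refine Flow.omegaLimit_subset_of_isClosed (C := {y | 1 / m / 2 ≤ P y})
        (isClosed_le continuous_const h.contP) ?_ hy
      filter_upwards [eventually_ge_atTop T] with t ht
      by_contra hcon
      obtain ⟨s, hs, hes⟩ := isPreconnected_Ici.intermediate_value (mem_Ici.2 ht) self_mem_Ici
        hcont ⟨(not_le.1 hcon).le, hge⟩
      exact hT s hs hes
    refine (key y hy).resolve_left fun h1 => ?_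
    rw [h1.2] at hle
    linarith

end IsWarpedFlow

/-! ### Uniqueness of the orbit tending to `F_A`: the cone estimate. -/

/-- The coefficients of the quadratic form in the cone estimate near the equilibrium
`P = 0`, `A = 0`. -/
theorem exists_cone_radius {m n : ℝ} (hn : 2 ≤ n) : ∃ r > 0, ∀ p q u : ℝ,
    |p| < r → |q| < r → |u| < r →
    1 / 4 < 1 - 1 / n + 2 * m / n * (p + q) - (m + m ^ 2 / n) * (p ^ 2 + p * q + q ^ 2) ∧
    9 / 4 < n ^ 2 * (2 / n - (2 + 4 * m / n) * p + 2 * (m + m ^ 2 / n) * p ^ 2) ∧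
    |n ^ 2 * u * (-(2 + 4 * m / n) + 2 * (m + m ^ 2 / n) * (p + q))| < 1 / 2 := by
  have h1 : Continuous fun w : ℝ × ℝ × ℝ => 1 - 1 / n + 2 * m / n * (w.1 + w.2.1) -
      (m + m ^ 2 / n) * (w.1 ^ 2 + w.1 * w.2.1 + w.2.1 ^ 2) := by fun_prop
  have h2 : Continuous fun w : ℝ × ℝ × ℝ =>
      n ^ 2 * (2 / n - (2 + 4 * m / n) * w.1 + 2 * (m + m ^ 2 / n) * w.1 ^ 2) := by fun_prop
  have h3 : Continuous fun w : ℝ × ℝ × ℝ =>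
      |n ^ 2 * w.2.2 * (-(2 + 4 * m / n) + 2 * (m + m ^ 2 / n) * (w.1 + w.2.1))| := by fun_prop
  have hn' : 1 / n ≤ 1 / 2 := one_div_le_one_div_of_le two_pos hn
  -- At the origin the three expressions are `1 - 1 / n ≥ 1 / 2`, `2 n ≥ 4` and 0, so the strict
  -- bounds persist nearby.
  have e1 := (h1.tendsto (0, 0, 0)).eventually_const_lt (u := 1 / 4) (by
    norm_num at hn' ⊢; linarith)
  have e2 := (h2.tendsto (0, 0, 0)).eventually_const_lt (u := 9 / 4) (by
    have : n ^ 2 * (2 / n) = 2 * n := by field_simp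
    simp only [mul_zero, sub_zero, ne_eq, OfNat.ofNat_ne_zero, not_false_eq_true, zero_pow,
      add_zero, this]
    linarith)
  have e3 := (h3.tendsto (0, 0, 0)).eventually_lt_const (u := 1 / 2) (by norm_num)
  obtain ⟨r, hr, H⟩ := Metric.eventually_nhds_iff.1 (e1.and (e2.and e3))
  refine ⟨r, hr, fun p q u hp hq hu => H (y := (p, q, u)) ?_⟩
  simp [Prod.dist_eq, hp, hq, hu]

/-- The cross coefficient has modulus below `3 / 2`, and the extremal forms are the squares `(d / 2
± 3 u / 2)²`; hence the constants `1 / 4` and `9 / 4`. -/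
theorem cone_form_nonneg {F g G : ℝ} (hF : 1 / 4 < F) (hg : 9 / 4 < g) (hG : |G| < 1 / 2)
    (d u : ℝ) : 0 ≤ F * d ^ 2 + (G - 1) * (d * u) + g * u ^ 2 := by
  obtain ⟨h1, h2⟩ := abs_lt.1 hG
  have k1 : 0 ≤ (F - 1 / 4) * d ^ 2 := mul_nonneg (by linarith) (sq_nonneg _)
  have k2 : 0 ≤ (g - 9 / 4) * u ^ 2 := mul_nonneg (by linarith) (sq_nonneg _)
  rcases le_total 0 (d * u) with k3 | k3
  · linarith [sq_nonneg (d / 2 - 3 / 2 * u), mul_nonneg (by linarith : 0 ≤ G + 1 / 2) k3]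
  · linarith [sq_nonneg (d / 2 + 3 / 2 * u),
      mul_nonneg (by linarith : 0 ≤ 5 / 2 - G) (neg_nonneg.2 k3)]

namespace IsWarpedFlow

variable {m n : ℕ} {X : Type*} [TopologicalSpace X] {φ : Flow ℝ X} {A B P Q : X → ℝ} {x y : X}

/-- The constraints determine `Q` and `B²`, and `B` is nonnegative; so `A` and `P` are coordinates.
-/
theorem eq_of_A_eq_of_P_eq (h : IsWarpedFlow m n φ A B P Q) (hA : A x = A y) (hP : P x = P y) :
    x = y := by
  have hm := h.hm
  have hn := h.hn
  have hQ : Q x = Q y := by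
    have h1 := h.trace x
    have h2 := h.trace y
    rw [hP] at h1
    exact mul_left_cancel₀ (by positivity : (n : ℝ) ≠ 0) (by linarith)
  have hB : B x ^ 2 = B y ^ 2 := by
    have h1 := h.ham x
    have h2 := h.ham y
    rw [hP, hQ, hA] at h1
    have : (0 : ℝ) < (m + n - 1) * n := mul_pos (by linarith) (by linarith)
    exact mul_left_cancel₀ this.ne' (by linarith)
  exact h.inj x y hA ((sq_eq_sq₀ (h.nonnegB x) (h.nonnegB y)).1 hB) hP hQ

theorem sigma_eq (h : IsWarpedFlow m n φ A B P Q) (x : X) :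
    m * P x ^ 2 + n * Q x ^ 2 = 1 / n - 2 * m / n * P x + (m + (m : ℝ) ^ 2 / n) * P x ^ 2 := by
  have hn := h.hn
  have hQ : Q x = (1 - m * P x) / n := by
    rw [eq_div_iff (by positivity)]
    linarith [h.trace x]
  rw [hQ]
  field_simp
  ring

theorem hasDerivAt_A_sq (h : IsWarpedFlow m n φ A B P Q) (x : X) (t : ℝ) :
    HasDerivAt (fun s => ((m : ℝ) + n - 1) * A (φ s x) ^ 2)
      (((m : ℝ) + n - 1) * A (φ t x) ^ 2 *
        (2 * (P (φ t x) - (m * P (φ t x) ^ 2 + n * Q (φ t x) ^ 2)))) t := by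
  convert! ((h.derivA x t).pow 2).const_mul ((m : ℝ) + n - 1) using 1
  simp only [Nat.cast_ofNat, Nat.add_one_sub_one, pow_one]
  ring

/-- Two orbits that converge to the equilibrium with `A = P = 0` within a small neighbourhood
of it and start with the same value of `A` coincide. -/
theorem eq_of_tendsto_of_A_eq (h : IsWarpedFlow m n φ A B P Q) {r : ℝ}
    (hr : ∀ p q u : ℝ, |p| < r → |q| < r → |u| < r →
      1 / 4 < 1 - 1 / (n : ℝ) + 2 * m / n * (p + q) -
        (m + (m : ℝ) ^ 2 / n) * (p ^ 2 + p * q + q ^ 2) ∧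
      9 / 4 < (n : ℝ) ^ 2 * (2 / n - (2 + 4 * m / n) * p + 2 * (m + (m : ℝ) ^ 2 / n) * p ^ 2) ∧
      |(n : ℝ) ^ 2 * u * (-(2 + 4 * m / n) + 2 * (m + (m : ℝ) ^ 2 / n) * (p + q))| < 1 / 2)
    (hxy : A x = A y) (hPx : ∀ t, 0 ≤ t → |P (φ t x)| < r) (hPy : ∀ t, 0 ≤ t → |P (φ t y)| < r)
    (hAy : ∀ t, 0 ≤ t → |((m : ℝ) + n - 1) * A (φ t y) ^ 2| < r)
    (lPx : Tendsto (fun t => P (φ t x)) atTop (𝓝 0))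
    (lPy : Tendsto (fun t => P (φ t y)) atTop (𝓝 0))
    (lAx : Tendsto (fun t => A (φ t x)) atTop (𝓝 0))
    (lAy : Tendsto (fun t => A (φ t y)) atTop (𝓝 0)) : x = y := by
  refine h.eq_of_A_eq_of_P_eq hxy ?_
  -- The cone `H ≤ 0` compares the differences of `P` and of `u = (m + n - 1) A²`. The weight `n²`
  -- raises the diagonal coefficient from `2 / n` to `2 n`, enough to dominate the cross term.
  -- Increasing to the limit 0, `H` is nonpositive at time 0, where the `u` difference vanishes.
  set H : ℝ → ℝ := fun t => (P (φ t x) - P (φ t y)) ^ 2 - (n : ℝ) ^ 2 *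
    (((m : ℝ) + n - 1) * A (φ t x) ^ 2 - ((m : ℝ) + n - 1) * A (φ t y) ^ 2) ^ 2 with hH
  have hlim : Tendsto H atTop (𝓝 0) := by
    have := ((lPx.sub lPy).pow 2).sub ((((lAx.pow 2).const_mul ((m : ℝ) + n - 1)).sub
      ((lAy.pow 2).const_mul ((m : ℝ) + n - 1))).pow 2 |>.const_mul ((n : ℝ) ^ 2))
    simpa using this
  have hd : ∀ t, HasDerivAt H _ t := fun t =>
    (((h.derivP x t).sub (h.derivP y t)).pow 2).sub
      ((((h.hasDerivAt_A_sq x t).sub (h.hasDerivAt_A_sq y t)).pow 2).const_mul ((n : ℝ) ^ 2))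
  have hmono : MonotoneOn H (Ici 0) := by
    refine monotoneOn_of_hasDerivWithinAt_nonneg (convex_Ici 0)
      (HasDerivAt.continuousOn fun t _ => hd t) (fun t _ => (hd t).hasDerivWithinAt) fun t ht => ?_
    rw [interior_Ici, mem_Ioi] at ht
    obtain ⟨h1, h2, h3⟩ := hr _ _ _ (hPx t ht.le) (hPy t ht.le) (hAy t ht.le)
    simp only [Nat.cast_ofNat, Nat.add_one_sub_one, pow_one, Pi.sub_apply, h.sigma_eq]
    set p := P (φ t x)
    set q := P (φ t y)
    set u := ((m : ℝ) + n - 1) * A (φ t x) ^ 2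
    set v := ((m : ℝ) + n - 1) * A (φ t y) ^ 2
    refine le_of_le_of_eq
      (mul_nonneg two_pos.le (cone_form_nonneg h1 h2 h3 (p - q) (u - v))) ?_
    ring
  have h0 : H 0 ≤ 0 := by
    refine ge_of_tendsto hlim ?_
    filter_upwards [eventually_ge_atTop 0] with t ht
    exact hmono self_mem_Ici (mem_Ici.2 ht) ht
  simp only [hH, Flow.map_zero, id, hxy] at h0
  have : (P x - P y) ^ 2 = 0 := le_antisymm (by linarith) (sq_nonneg _)
  linarith [pow_eq_zero_iff two_ne_zero |>.1 this]

/-- There is at most one orbit with `A ≠ 0` that converges to the equilibrium with `A = P = 0`. -/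
theorem mem_orbit_of_omegaLimit [CompactSpace X] (h : IsWarpedFlow m n φ A B P Q) (hx : A x ≠ 0)
    (hy : A y ≠ 0) (hωx : ∀ z ∈ ω⁺ φ {x}, A z = 0 ∧ P z = 0)
    (hωy : ∀ z ∈ ω⁺ φ {y}, A z = 0 ∧ P z = 0) : φ.orbit x = φ.orbit y := by
  obtain ⟨r, hr0, hr⟩ := exists_cone_radius (m := m) h.hn
  have hP : ∀ z, (∀ w ∈ ω⁺ φ {z}, A w = 0 ∧ P w = 0) →
      Tendsto (fun t => P (φ t z)) atTop (𝓝 0) := fun z hz =>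
    Flow.tendsto_of_forall_omegaLimit h.contP fun w hw => (hz w hw).2
  have hA : ∀ z, (∀ w ∈ ω⁺ φ {z}, A w = 0 ∧ P w = 0) →
      Tendsto (fun t => A (φ t z)) atTop (𝓝 0) := fun z hz =>
    Flow.tendsto_of_forall_omegaLimit h.contA fun w hw => (hz w hw).1
  have hu : ∀ z, (∀ w ∈ ω⁺ φ {z}, A w = 0 ∧ P w = 0) →
      Tendsto (fun t => ((m : ℝ) + n - 1) * A (φ t z) ^ 2) atTop (𝓝 0) := fun z hz => by
    simpa using ((hA z hz).pow 2).const_mul ((m : ℝ) + n - 1)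
  have hT : ∀ z, (∀ w ∈ ω⁺ φ {z}, A w = 0 ∧ P w = 0) → ∀ᶠ T in atTop, ∀ t, T ≤ t →
      |P (φ t z)| < r ∧ |((m : ℝ) + n - 1) * A (φ t z) ^ 2| < r := fun z hz => by
    refine eventually_forall_ge_atTop.2 ?_
    have e1 := (hP z hz).abs.eventually_lt_const (u := r) (by simpa using hr0)
    have e2 := (hu z hz).abs.eventually_lt_const (u := r) (by simpa using hr0)
    exact e1.and e2
  have key : ∀ (x y : X) (T : ℝ), A y ≠ 0 →
      (∀ z ∈ ω⁺ φ {x}, A z = 0 ∧ P z = 0) → (∀ z ∈ ω⁺ φ {y}, A z = 0 ∧ P z = 0) →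
      (∀ t, T ≤ t → |P (φ t x)| < r ∧ |((m : ℝ) + n - 1) * A (φ t x) ^ 2| < r) →
      (∀ t, T ≤ t → |P (φ t y)| < r ∧ |((m : ℝ) + n - 1) * A (φ t y) ^ 2| < r) →
      A (φ T y) ≤ A (φ T x) → ∃ t s, φ t x = φ s y := by
    intro x y T hy hωx hωy hTx hTy hle
    -- `A` tends to 0 along the orbit of `x`, so it falls from above `A (φ T y)` to below it; at the
    -- crossing time both orbits have the same `A`.
    obtain ⟨S, hS⟩ := ((hA x hωx).eventually_lt_const (h.A_flow_pos hy T)).and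
      (eventually_ge_atTop T) |>.exists
    obtain ⟨T', hT', he⟩ := intermediate_value_Icc' hS.2
      (h.contA.comp (continuous_flow_left φ x)).continuousOn ⟨hS.1.le, hle⟩
    refine ⟨T', T, h.eq_of_tendsto_of_A_eq hr he ?_ ?_ ?_ ?_ ?_ ?_ ?_⟩
    · intro t ht
      rw [← Flow.map_add]
      exact (hTx _ (by linarith [hT'.1])).1
    · intro t ht
      rw [← Flow.map_add]
      exact (hTy _ (by linarith)).1
    · intro t ht
      rw [← Flow.map_add]
      exact (hTy _ (by linarith)).2
    · simpa only [← Flow.map_add, Function.comp_def, id] using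
        (hP x hωx).comp (tendsto_atTop_add_const_right atTop T' tendsto_id)
    · simpa only [← Flow.map_add, Function.comp_def, id] using
        (hP y hωy).comp (tendsto_atTop_add_const_right atTop T tendsto_id)
    · simpa only [← Flow.map_add, Function.comp_def, id] using
        (hA x hωx).comp (tendsto_atTop_add_const_right atTop T' tendsto_id)
    · simpa only [← Flow.map_add, Function.comp_def, id] using
        (hA y hωy).comp (tendsto_atTop_add_const_right atTop T tendsto_id)
  have hex : ∃ t s, φ t x = φ s y := by
    obtain ⟨T, hTx, hTy⟩ := ((hT x hωx).and (hT y hωy)).exists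
    rcases le_total (A (φ T y)) (A (φ T x)) with hle | hle
    · exact key x y T hy hωx hωy hTx hTy hle
    · obtain ⟨t, s, e⟩ := key y x T hx hωy hωx hTy hTx hle
      exact ⟨s, t, e.symm⟩
  obtain ⟨t, s, e⟩ := hex
  have hxy : ∀ (x y : X) (t s : ℝ), φ t x = φ s y → φ.orbit y ⊆ φ.orbit x := by
    rintro x y t s e _ ⟨τ, rfl⟩
    refine ⟨τ - s + t, ?_⟩
    change φ (τ - s + t) x = φ τ y
    rw [Flow.map_add, e, ← Flow.map_add, sub_add_cancel]
  exact Subset.antisymm (hxy y x s t e.symm) (hxy x y t s e)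

end IsWarpedFlow
end WarpedProduct

/-! ### Existence of an orbit tending to `F_A`: shooting. -/

theorem HasDerivAt.exists_Ioo_lt_of_neg {g : ℝ → ℝ} {d s : ℝ} (hg : HasDerivAt g d s)
    (hd : d < 0) : ∃ b > s, ∀ t ∈ Ioo s b, g t < g s := by
  have h := (hasDerivAt_iff_tendsto_slope.1 hg).eventually_lt_const hd
  have h' : ∀ᶠ t in 𝓝[>] s, slope g s t < 0 :=
    h.filter_mono (nhdsWithin_mono s fun t (ht : s < t) => ht.ne')
  obtain ⟨b, hb, hsub⟩ := (mem_nhdsGT_iff_exists_Ioo_subset).1 h'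
  refine ⟨b, hb, fun t ht => ?_⟩
  have := hsub ht
  rw [mem_ofPred_eq, slope_def_field, div_neg_iff] at this
  rcases this with h1 | h1
  · linarith [ht.1, h1.2]
  · linarith [h1.1]

/-- A continuous function on `[0, ∞)` either stays in an open interval or reaches one of its end
points after having stayed in it. -/
theorem exists_first_exit {g : ℝ → ℝ} {d : ℝ} (hg : Continuous g) (h0 : g 0 ∈ Icc 0 d)
    (h : ¬ ∀ t, 0 ≤ t → g t ∈ Ioo 0 d) :
    ∃ s, 0 ≤ s ∧ (∀ t, 0 ≤ t → t < s → g t ∈ Ioo 0 d) ∧ (∀ t ∈ Icc 0 s, g t ∈ Icc 0 d) ∧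
      (g s = 0 ∨ g s = d) := by
  push Not at h
  set T : Set ℝ := {t | 0 ≤ t ∧ g t ∉ Ioo 0 d} with hT
  have hclosed : IsClosed T :=
    (isClosed_le continuous_const continuous_id).inter ((isOpen_Ioo.preimage hg).isClosed_compl)
  have hbdd : BddBelow T := ⟨0, fun t ht => ht.1⟩
  have hmem := hclosed.csInf_mem h hbdd
  have hlt : ∀ t, 0 ≤ t → t < sInf T → g t ∈ Ioo 0 d := fun t ht hts => by
    by_contra hcon
    exact notMem_of_lt_csInf hts hbdd ⟨ht, hcon⟩
  have hIcc : ∀ t ∈ Icc 0 (sInf T), g t ∈ Icc 0 d := by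
    rcases hmem.1.eq_or_lt with he | hl
    · intro t ht
      rw [← he] at ht
      rwa [le_antisymm ht.2 ht.1]
    · intro t ht
      rw [← closure_Ico hl.ne] at ht
      exact closure_minimal (t := g ⁻¹' Icc 0 d) (fun t ht => Ioo_subset_Icc_self (hlt t ht.1 ht.2))
        (isClosed_Icc.preimage hg) ht
  refine ⟨sInf T, hmem.1, hlt, hIcc, ?_⟩
  have h1 := hIcc (sInf T) ⟨hmem.1, le_rfl⟩
  have h2 := hmem.2
  by_contra! hcon
  exact h2 ⟨h1.1.lt_of_ne hcon.1.symm, h1.2.lt_of_ne hcon.2⟩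

/-- The points that a flow keeps in an open set during a compact time interval form an
open set. -/
theorem Flow.isOpen_forall_Icc {X : Type*} [TopologicalSpace X] (φ : Flow ℝ X) {U : Set X}
    (hU : IsOpen U) (a b : ℝ) : IsOpen {x | ∀ s ∈ Icc a b, φ s x ∈ U} := by
  rw [isOpen_iff_eventually]
  intro x hx
  refine isCompact_Icc.eventually_forall_of_forall_eventually fun s hs => ?_
  have : Continuous fun p : X × ℝ => φ p.2 p.1 := φ.continuous continuous_snd continuous_fst
  exact this.continuousAt.eventually_mem (hU.mem_nhds (hx s hs))

namespace WarpedProduct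
namespace IsWarpedFlow

variable {m n : ℕ} {X : Type*} [TopologicalSpace X] {φ : Flow ℝ X} {A B P Q : X → ℝ} {x y : X}

/-- The pairs `(A, P)` of the points with `A > 0` and `B > 0`. -/
def chartDomain (m n : ℕ) : Set (ℝ × ℝ) :=
  {w | 0 < w.1 ∧ m * w.2 ^ 2 + n * ((1 - m * w.2) / n) ^ 2 + (m + n - 1) * (m * w.1 ^ 2) < 1}

theorem isOpen_chartDomain (m n : ℕ) : IsOpen (chartDomain m n) := by
  have h1 : IsOpen {w : ℝ × ℝ | 0 < w.1} := isOpen_lt continuous_const continuous_fst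
  have h2 : IsOpen {w : ℝ × ℝ | m * w.2 ^ 2 + n * ((1 - m * w.2) / n) ^ 2 +
      (m + n - 1) * (m * w.1 ^ 2) < 1} := isOpen_lt (by fun_prop) continuous_const
  exact h1.inter h2

theorem mem_chartDomain (h : IsWarpedFlow m n φ A B P Q) (hA : A x ≠ 0) (hB : B x ≠ 0) :
    (A x, P x) ∈ chartDomain m n := by
  have hm := h.hm
  have hn := h.hn
  refine ⟨(h.nonnegA x).lt_of_ne' hA, ?_⟩
  have hQ : (1 - m * P x) / n = Q x := by
    rw [div_eq_iff (by positivity)]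
    linarith [h.trace x]
  have : (0 : ℝ) < (m + n - 1) * (n * B x ^ 2) :=
    mul_pos (by linarith) (by positivity)
  simp only [hQ]
  linarith [h.ham x]

/-- The functions `A` and `P` are coordinates on the set of points with `A > 0` and `B > 0`. -/
theorem exists_chart [CompactSpace X] (h : IsWarpedFlow m n φ A B P Q) :
    ∃ γ : chartDomain m n → X, Continuous γ ∧
      ∀ w, A (γ w) = w.1.1 ∧ P (γ w) = w.1.2 ∧ B (γ w) ≠ 0 := by
  have hm := h.hm
  have hn := h.hn
  have hN : (0 : ℝ) < (m + n - 1) * n := mul_pos (by linarith) (by linarith)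
  let b : chartDomain m n → ℝ := fun w => √((1 - (m * w.1.2 ^ 2 + n * ((1 - m * w.1.2) / n) ^ 2 +
    (m + n - 1) * (m * w.1.1 ^ 2))) / ((m + n - 1) * n))
  have hb : ∀ w, 0 < b w := fun w => Real.sqrt_pos.2 (div_pos (sub_pos.2 w.2.2) hN)
  have key : ∀ w : chartDomain m n, ∃ x, A x = w.1.1 ∧ B x = b w ∧ P x = w.1.2 ∧
      Q x = (1 - m * w.1.2) / n := by
    intro w
    refine h.surj _ _ _ _ w.2.1 (hb w) (by field_simp; ring) ?_
    have hsq : ((m : ℝ) + n - 1) * n * b w ^ 2 = 1 - (m * w.1.2 ^ 2 +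
        n * ((1 - m * w.1.2) / n) ^ 2 + (m + n - 1) * (m * w.1.1 ^ 2)) := by
      rw [Real.sq_sqrt (div_pos (sub_pos.2 w.2.2) hN).le, mul_div_cancel₀ _ hN.ne']
    linarith
  choose γ hγ using key
  have hι : IsEmbedding fun x => (A x, B x, P x, Q x) :=
    (Continuous.isClosedEmbedding (h.contA.prodMk (h.contB.prodMk (h.contP.prodMk h.contQ)))
      fun x y hxy => by
        simp only [Prod.mk.injEq] at hxy
        exact h.inj x y hxy.1 hxy.2.1 hxy.2.2.1 hxy.2.2.2).isEmbedding
  refine ⟨γ, ?_, fun w => ⟨(hγ w).1, (hγ w).2.2.1, by rw [(hγ w).2.1]; exact (hb w).ne'⟩⟩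
  rw [hι.continuous_iff]
  simp only [Function.comp_def, hγ]
  fun_prop

/-- By Cauchy–Schwarz and the trace constraint, `σ ≥ 1 / (m + n) = 2 d`; hence `P - σ < 0` while `P
≤ d`. -/
theorem A_le_of_forall_P_mem (h : IsWarpedFlow m n φ A B P Q) {d s : ℝ}
    (hd : d * (2 * (m + n)) = 1) (hP : ∀ t ∈ Icc 0 s, P (φ t x) ∈ Icc 0 d) (hs : 0 ≤ s) :
    A (φ s x) ≤ A x := by
  have hm := h.hm
  have hn := h.hn
  have hanti : AntitoneOn (fun t => A (φ t x)) (Icc 0 s) := by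
    refine antitoneOn_of_hasDerivWithinAt_nonpos (convex_Icc 0 s)
      (h.contA.comp (continuous_flow_left φ x)).continuousOn
      (fun t _ => (h.derivA x t).hasDerivWithinAt) fun t ht => ?_
    refine mul_nonpos_of_nonneg_of_nonpos (h.nonnegA _) ?_
    have hle := (hP t (interior_subset ht)).2
    have htr := h.trace (φ t x)
    set p := P (φ t x)
    set q := Q (φ t x)
    have h1 : 1 ≤ ((m : ℝ) + n) * (m * p ^ 2 + n * q ^ 2) := by
      have e : ((m : ℝ) + n) * (m * p ^ 2 + n * q ^ 2) = (m * p + n * q) ^ 2 +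
        m * n * (p - q) ^ 2 := by ring
      rw [e, htr]
      have : 0 ≤ (m : ℝ) * n * (p - q) ^ 2 := by positivity
      linarith
    have h2 : ((m : ℝ) + n) * p ≤ (m + n) * d := mul_le_mul_of_nonneg_left hle (by linarith)
    have h3 : ((m : ℝ) + n) * (p - (m * p ^ 2 + n * q ^ 2)) ≤ 0 := by linarith
    exact nonpos_of_mul_nonpos_right h3 (by linarith)
  have := hanti (left_mem_Icc.2 hs) (right_mem_Icc.2 hs) hs
  simpa using this

/-- At `P = 0` the derivative is `-(m + n - 1) A² < 0`, so the lower end is crossed strictly; strict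
crossing is an open condition. -/
theorem exists_P_neg_of_eq_zero (h : IsWarpedFlow m n φ A B P Q) (hA : A x ≠ 0) {d s : ℝ}
    (hd : 0 < d) (hs : 0 ≤ s) (hlt : ∀ t, 0 ≤ t → t < s → P (φ t x) ∈ Ioo 0 d)
    (hPs : P (φ s x) = 0) :
    ∃ t, 0 ≤ t ∧ P (φ t x) < 0 ∧ ∀ r ∈ Icc 0 t, P (φ r x) < d := by
  have hm := h.hm
  have hn := h.hn
  have hApos := h.A_flow_pos hA s
  obtain ⟨b, hb, H⟩ := (h.derivP x s).exists_Ioo_lt_of_neg (by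
    rw [hPs]
    have : (0 : ℝ) < (m + n - 1) * A (φ s x) ^ 2 := mul_pos (by linarith) (by positivity)
    linarith)
  rw [hPs] at H
  refine ⟨(s + b) / 2, by linarith, H _ ⟨by linarith, by linarith⟩, fun r hr => ?_⟩
  rcases lt_trichotomy r s with h1 | h1 | h1
  · exact (hlt r hr.1 h1).2
  · rw [h1, hPs]
    exact hd
  · exact (H r ⟨h1, by linarith [hr.2]⟩).trans hd

/-- At `P = d` one has `σ ≤ 1 / 2` and, as `A` has not grown, `(m + n - 1) A² ≤ d / 4`; thus `P' ≥ d
/ 2 - d / 4 > 0` and the crossing is strict. -/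
theorem exists_P_gt_of_eq (h : IsWarpedFlow m n φ A B P Q) {d s : ℝ}
    (hd : d * (2 * (m + n)) = 1) (hAx : ((m : ℝ) + n - 1) * A x ^ 2 = d / 4) (hs : 0 ≤ s)
    (hlt : ∀ t, 0 ≤ t → t < s → P (φ t x) ∈ Ioo 0 d)
    (hle : ∀ t ∈ Icc 0 s, P (φ t x) ∈ Icc 0 d) (hPs : P (φ s x) = d) :
    ∃ t, 0 ≤ t ∧ d < P (φ t x) ∧ ∀ r ∈ Icc 0 t, 0 < P (φ r x) := by
  have hm := h.hm
  have hn := h.hn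
  have hd0 : 0 < d := pos_of_mul_pos_left (hd ▸ one_pos) (by positivity)
  have hAs : A (φ s x) ^ 2 ≤ A x ^ 2 :=
    pow_le_pow_left₀ (h.nonnegA _) (h.A_le_of_forall_P_mem hd hle hs) 2
  have hσ : (m : ℝ) * P (φ s x) ^ 2 + n * Q (φ s x) ^ 2 ≤ 1 / 2 := by
    rw [h.sigma_eq, hPs]
    have hmd : m * d ≤ 1 / 2 := by nlinarith [mul_pos hd0 (by linarith : (0 : ℝ) < n)]
    have hde : d = 1 / (2 * (m + n)) := by rw [eq_div_iff (by positivity)]; exact hd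
    have e : 1 / (n : ℝ) - 2 * m / n * d + (m + (m : ℝ) ^ 2 / n) * d ^ 2 =
        (4 * n + m) / (4 * n * (m + n)) := by
      rw [hde]
      field_simp
      ring
    rw [e, div_le_div_iff₀ (by positivity) two_pos]
    nlinarith
  obtain ⟨b, hb, H⟩ := (h.derivP x s).neg.exists_Ioo_lt_of_neg (by
    have h1 : ((m : ℝ) + n - 1) * A (φ s x) ^ 2 ≤ d / 4 :=
      hAx ▸ mul_le_mul_of_nonneg_left hAs (by linarith)
    rw [hPs] at hσ ⊢
    nlinarith)
  simp only [Pi.neg_apply, neg_lt_neg_iff, hPs] at H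
  refine ⟨(s + b) / 2, by linarith, H _ ⟨by linarith, by linarith⟩, fun r hr => ?_⟩
  rcases lt_trichotomy r s with h1 | h1 | h1
  · exact (hlt r hr.1 h1).1
  · rw [h1, hPs]
    exact hd0
  · exact hd0.trans (H r ⟨h1, by linarith [hr.2]⟩)

/-- Some orbit with `A B ≠ 0` keeps `P` in a bounded interval to the left of its value at the
interior equilibrium. -/
theorem exists_forall_P_mem_Ioo [CompactSpace X] (h : IsWarpedFlow m n φ A B P Q) {d : ℝ}
    (hd : d * (2 * (m + n)) = 1) :
    ∃ x, A x ≠ 0 ∧ B x ≠ 0 ∧ ∀ t, 0 ≤ t → P (φ t x) ∈ Ioo 0 d := by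
  have hm := h.hm
  have hn := h.hn
  have hd0 : 0 < d := pos_of_mul_pos_left (hd ▸ one_pos) (by positivity)
  have hN : (0 : ℝ) < m + n - 1 := by linarith
  obtain ⟨γ, hγc, hγ⟩ := h.exists_chart
  set a := √(d / 4 / (m + n - 1)) with ha
  have ha0 : 0 < a := Real.sqrt_pos.2 (by positivity)
  have hasq : ((m : ℝ) + n - 1) * a ^ 2 = d / 4 := by
    rw [ha, Real.sq_sqrt (by positivity), mul_div_cancel₀ _ hN.ne']
  have hdom : ∀ p ∈ Icc 0 d, (a, p) ∈ chartDomain m n := by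
    intro p hp
    refine ⟨ha0, ?_⟩
    have hmd : m * d ≤ 1 / 2 := by nlinarith [mul_pos hd0 (by linarith : (0 : ℝ) < n)]
    have hmp : m * p ≤ m * d := mul_le_mul_of_nonneg_left hp.2 (by linarith)
    have hmp0 : 0 ≤ m * p := mul_nonneg (by linarith) hp.1
    have h1 : (n : ℝ) * ((1 - m * p) / n) ^ 2 = (1 - m * p) ^ 2 * (1 / n) := by
      field_simp
    have h2 : (1 : ℝ) / n ≤ 1 / 2 := one_div_le_one_div_of_le two_pos hn
    have h3 : (1 - m * p) ^ 2 * (1 / (n : ℝ)) ≤ (1 - m * p) * (1 / 2) :=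
      mul_le_mul (by nlinarith) h2 (by positivity) (by linarith)
    have h4 : (m : ℝ) * p ^ 2 ≤ m * p * (1 / 4) := by
      have : p ≤ 1 / 4 := by nlinarith [hp.2]
      nlinarith
    have h5 : ((m : ℝ) + n - 1) * (m * a ^ 2) = m * d / 4 := by linear_combination m * hasq
    simp only [h1, h5]
    linarith
  let ψ : Icc 0 d → X := fun p => γ ⟨(a, p), hdom p p.2⟩
  have hψc : Continuous ψ := hγc.comp (by fun_prop)
  have hψA : ∀ p, A (ψ p) = a := fun p => (hγ _).1
  have hψP : ∀ p, P (ψ p) = p := fun p => (hγ _).2.1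
  have hψA0 : ∀ p, A (ψ p) ≠ 0 := fun p => hψA p ▸ ha0.ne'
  -- Exit through one end before reaching the other. Compactness of the time interval makes both
  -- sets open, and the condition on earlier times makes them disjoint.
  let E₁ : Set X := ⋃ t ∈ Ici (0 : ℝ), {x | P (φ t x) < 0} ∩ {x | ∀ r ∈ Icc 0 t, P (φ r x) < d}
  let E₂ : Set X := ⋃ t ∈ Ici (0 : ℝ), {x | d < P (φ t x)} ∩ {x | ∀ r ∈ Icc 0 t, 0 < P (φ r x)}
  have hPt : ∀ t, Continuous fun x => P (φ t x) := fun t => h.contP.comp (φ.continuous_toFun t)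
  have hE₁ : IsOpen E₁ := isOpen_biUnion fun t _ => (isOpen_lt (hPt t) continuous_const).inter
    (φ.isOpen_forall_Icc (isOpen_lt h.contP continuous_const) 0 t)
  have hE₂ : IsOpen E₂ := isOpen_biUnion fun t _ => (isOpen_lt continuous_const (hPt t)).inter
    (φ.isOpen_forall_Icc (isOpen_lt continuous_const h.contP) 0 t)
  have mem₁ : ∀ {x}, (∃ t, 0 ≤ t ∧ P (φ t x) < 0 ∧ ∀ r ∈ Icc 0 t, P (φ r x) < d) → x ∈ E₁ :=
    fun ⟨t, ht, h1, h2⟩ => mem_biUnion (mem_Ici.2 ht) ⟨h1, h2⟩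
  have mem₂ : ∀ {x}, (∃ t, 0 ≤ t ∧ d < P (φ t x) ∧ ∀ r ∈ Icc 0 t, 0 < P (φ r x)) → x ∈ E₂ :=
    fun ⟨t, ht, h1, h2⟩ => mem_biUnion (mem_Ici.2 ht) ⟨h1, h2⟩
  by_contra! hcon
  have hcover : ∀ p, ψ p ∈ E₁ ∪ E₂ := by
    intro p
    have hnot := hcon (ψ p) (hψA0 p) (hγ _).2.2
    obtain ⟨s, hs, hlt, hle, hor⟩ := exists_first_exit (g := fun t => P (φ t (ψ p))) (d := d)
      (h.contP.comp (continuous_flow_left φ _))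
      (by simpa only [Flow.map_zero, id, hψP] using p.2) (by push Not; exact hnot)
    rcases hor with h1 | h1
    · exact Or.inl (mem₁ (h.exists_P_neg_of_eq_zero (hψA0 p) hd0 hs hlt h1))
    · exact Or.inr (mem₂ (h.exists_P_gt_of_eq hd (by rw [hψA, hasq]) hs hlt hle h1))
  -- The segment cannot be split by the two open exit sets, each of which contains one of its ends.
  have hpre : IsPreconnected (univ : Set (Icc 0 d)) :=
    (isPreconnected_iff_preconnectedSpace.1 isPreconnected_Icc).isPreconnected_univ
  obtain ⟨p, -, hp1, hp2⟩ := hpre _ _ (hE₁.preimage hψc) (hE₂.preimage hψc)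
    (fun p _ => hcover p)
    ⟨⟨0, left_mem_Icc.2 hd0.le⟩, trivial, mem₁ (h.exists_P_neg_of_eq_zero (hψA0 _) hd0 le_rfl
      (fun t h1 h2 => absurd h2 h1.not_gt) (by simp [hψP]))⟩
    ⟨⟨d, right_mem_Icc.2 hd0.le⟩, trivial, mem₂ (h.exists_P_gt_of_eq hd (by rw [hψA, hasq]) le_rfl
      (fun t h1 h2 => absurd h2 h1.not_gt)
      (fun t ht => by
        rw [le_antisymm ht.2 ht.1]
        simpa [hψP] using hd0.le) (by simp [hψP]))⟩
  obtain ⟨t₁, ht₁, h1, h2⟩ := mem_iUnion₂.1 hp1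
  obtain ⟨t₂, ht₂, h3, h4⟩ := mem_iUnion₂.1 hp2
  rcases le_total t₁ t₂ with hle | hle
  · exact absurd (h4 t₁ ⟨ht₁, hle⟩) h1.not_gt
  · exact absurd (h2 t₂ ⟨ht₂, hle⟩) h3.not_gt

/-- Some orbit with `A B ≠ 0` converges to the equilibrium with `A = P = 0`. -/
theorem exists_omegaLimit [CompactSpace X] (h : IsWarpedFlow m n φ A B P Q) :
    ∃ x, A x ≠ 0 ∧ B x ≠ 0 ∧ ∀ y ∈ ω⁺ φ {x}, A y = 0 ∧ P y = 0 := by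
  have hm := h.hm
  have hn := h.hn
  have hd : 1 / (2 * ((m : ℝ) + n)) * (2 * (m + n)) = 1 := by field_simp
  set d := 1 / (2 * ((m : ℝ) + n)) with hd'
  have hd0 : 0 < d := by positivity
  have hmd : m * d ≤ 1 / 2 := by nlinarith [mul_pos hd0 (by linarith : (0 : ℝ) < n)]
  obtain ⟨x, hA, hB, hx⟩ := h.exists_forall_P_mem_Ioo hd
  refine ⟨x, hA, hB, ?_⟩
  have hx0 := hx 0 le_rfl
  simp only [Flow.map_zero, id] at hx0
  have hQ : ∀ t, 0 ≤ t → 0 < Q (φ t x) := fun t ht => by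
    have h1 := h.trace (φ t x)
    have h2 := mul_le_mul_of_nonneg_left (hx t ht).2.le (by linarith : (0 : ℝ) ≤ m)
    exact pos_of_mul_pos_right (by linarith : 0 < (n : ℝ) * Q (φ t x)) (by linarith)
  have hstar : ¬ (A x = 1 / (m + n) ∧ B x = 1 / (m + n) ∧ P x = 1 / (m + n) ∧
      Q x = 1 / (m + n)) := fun hs => by
    have h1 := hx0.2
    rw [hs.2.2.1, hd', one_div_lt_one_div (by positivity) (by positivity)] at h1
    linarith
  rcases h.omegaLimit_cases hA hB hstar with ⟨t, ht⟩ | ⟨t, ht⟩ | h1 | h1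
  · have := h.P_flow_neg (le_max_left t 0) ht
    exact absurd this (hx _ (le_max_right t 0)).1.not_gt
  · have := h.symm.P_flow_neg (le_max_left t 0) ht
    exact absurd this (hQ _ (le_max_right t 0)).not_gt
  · exact h1
  -- `F_B` is excluded because `Q = 0` forces `m P = 1`, whereas `m P ≤ m d ≤ 1 / 2`.
  · obtain ⟨z, hz⟩ := nonempty_omegaLimit atTop φ {x} (singleton_nonempty x)
    have hPz : P z ≤ d := Flow.omegaLimit_subset_of_isClosed (C := {y | P y ≤ d})
      (isClosed_le h.contP continuous_const)
      (by filter_upwards [eventually_ge_atTop 0] with t ht using (hx t ht).2.le) hz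
    have h2 := h.trace z
    rw [(h1 z hz).2] at h2
    have := mul_le_mul_of_nonneg_left hPz (by linarith : (0 : ℝ) ≤ m)
    linarith

/-! ### Density through Hausdorff dimension. -/

theorem dimH_range_le (h : IsWarpedFlow m n φ A B P Q) (x : X) :
    dimH (range fun t => (A (φ t x), P (φ t x))) ≤ 1 := by
  have hA := h.contA.comp (continuous_flow_left φ x)
  have hP := h.contP.comp (continuous_flow_left φ x)
  have hσ := h.continuous_sigma_comp x
  have h1 : ContDiff ℝ 1 fun t => A (φ t x) := by
    rw [contDiff_one_iff_deriv]
    refine ⟨fun t => (h.derivA x t).differentiableAt, ?_⟩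
    rw [funext fun t => (h.derivA x t).deriv]
    exact hA.mul (hP.sub hσ)
  have h2 : ContDiff ℝ 1 fun t => P (φ t x) := by
    rw [contDiff_one_iff_deriv]
    refine ⟨fun t => (h.derivP x t).differentiableAt, ?_⟩
    rw [funext fun t => (h.derivP x t).deriv]
    exact (hP.mul (continuous_const.sub hσ)).sub (continuous_const.mul (hA.pow 2))
  simpa using (h1.prodMk h2).dimH_range_le

/-- A set of points with `A B ≠ 0` that is covered by finitely many orbits has a dense
complement. -/
theorem dense_of_compl_subset_orbits [CompactSpace X] (h : IsWarpedFlow m n φ A B P Q)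
    (hdense : Dense {x | A x ≠ 0 ∧ B x ≠ 0}) {x y z : X} {G : Set X}
    (hG : ∀ w, A w ≠ 0 → B w ≠ 0 → w ∉ G → w ∈ φ.orbit x ∨ w ∈ φ.orbit y ∨ w ∈ φ.orbit z) :
    Dense G := by
  obtain ⟨γ, hγc, hγ⟩ := h.exists_chart
  rw [dense_iff_inter_open]
  intro U hU hUne
  obtain ⟨w, hwU, hwA, hwB⟩ := hdense.inter_open_nonempty U hU hUne
  let R : X → Set (ℝ × ℝ) := fun x => range fun t => (A (φ t x), P (φ t x))
  have hdim : dimH (R x ∪ (R y ∪ R z)) < Module.finrank ℝ (ℝ × ℝ) := by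
    rw [dimH_union, dimH_union, Module.finrank_prod, Module.finrank_self]
    refine (max_le (h.dimH_range_le x)
      (max_le (h.dimH_range_le y) (h.dimH_range_le z))).trans_lt ?_
    norm_num
  have hV : IsOpen (Subtype.val '' (γ ⁻¹' U)) :=
    (isOpen_chartDomain m n).isOpenMap_subtype_val _ (hU.preimage hγc)
  have hwV : (A w, P w) ∈ Subtype.val '' (γ ⁻¹' U) := by
    have he : γ ⟨_, h.mem_chartDomain hwA hwB⟩ = w :=
      h.eq_of_A_eq_of_P_eq (hγ _).1 (hγ _).2.1
    exact ⟨⟨_, h.mem_chartDomain hwA hwB⟩, by rwa [mem_preimage, he], rfl⟩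
  obtain ⟨_, ⟨v, hvU, rfl⟩, hv⟩ :=
    (dense_compl_of_dimH_lt_finrank hdim).inter_open_nonempty _ hV ⟨_, hwV⟩
  refine ⟨γ v, hvU, by_contra fun hvG => hv ?_⟩
  have hmem : ∀ u, γ v ∈ φ.orbit u → v.1 ∈ R u := by
    rintro u ⟨t, ht⟩
    refine ⟨t, ?_⟩
    change φ t u = γ v at ht
    simp only [ht, (hγ v).1, (hγ v).2.1]
  rcases hG (γ v) (by rw [(hγ v).1]; exact v.2.1.ne') (hγ v).2.2 hvG with h1 | h1 | h1
  · exact Or.inl (hmem x h1)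
  · exact Or.inr (Or.inl (hmem y h1))
  · exact Or.inr (Or.inr (hmem z h1))

/-! ### Identification of the equilibria. -/

theorem eq_of_A_eq_zero_of_P_eq_zero (h : IsWarpedFlow m n φ A B P Q) (hA : A x = 0)
    (hP : P x = 0) : B x = √((n - 1) / n ^ 2 * (1 / (m + n - 1))) ∧ Q x = 1 / n := by
  have hm := h.hm
  have hn := h.hn
  have hN : ((m : ℝ) + n - 1) ≠ 0 := by linarith
  have hQ : Q x = 1 / n := by
    rw [eq_div_iff (by positivity)]
    have := h.trace x
    rw [hP] at this
    linarith
  refine ⟨?_, hQ⟩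
  rw [eq_comm, Real.sqrt_eq_iff_eq_sq
    (mul_nonneg (div_nonneg (by linarith) (by positivity)) (div_nonneg (by norm_num) (by linarith)))
    (h.nonnegB x)]
  have := h.ham x
  rw [hA, hP, hQ] at this
  field_simp at this ⊢
  linarith

theorem eq_of_P_neg (h : IsWarpedFlow m n φ A B P Q) (hA : A x = 0) (hB : B x = 0) (hP : P x < 0) :
    P x = 1 / (m + n) * (1 - n * √((m + n - 1) / (m * n))) ∧
      Q x = 1 / (m + n) * (1 + m * √((m + n - 1) / (m * n))) := by
  have hm := h.hm
  have hn := h.hn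
  have h1 := h.trace x
  have h2 := h.ham x
  rw [hA, hB] at h2
  have hQ : 0 < Q x := by
    have := mul_neg_of_pos_of_neg (by linarith : (0 : ℝ) < m) hP
    exact pos_of_mul_pos_right (by linarith : 0 < (n : ℝ) * Q x) (by linarith)
  have hs : √(((m : ℝ) + n - 1) / (m * n)) = Q x - P x := by
    rw [Real.sqrt_eq_iff_eq_sq (div_nonneg (by linarith) (by positivity)) (by linarith),
      div_eq_iff (by positivity)]
    linear_combination (m * P x + n * Q x + 1) * h1 - (m + n) * h2
  rw [hs]
  constructor
  · field_simp
    linarith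
  · field_simp
    linarith

/-- Replaces a condition on the limit set by one on finite times, from which openness of the basin
is immediate. -/
theorem exists_P_neg_iff (h : IsWarpedFlow m n φ A B P Q) (hne : (ω⁺ φ {x}).Nonempty) :
    (∃ t, P (φ t x) < 0) ↔ ∀ y ∈ ω⁺ φ {x}, A y = 0 ∧ B y = 0 ∧ P y < 0 := by
  refine ⟨fun ⟨t, ht⟩ => h.omegaLimit_of_P_neg ht, fun H => ?_⟩
  by_contra! hcon
  obtain ⟨y, hy⟩ := hne
  exact absurd (H y hy).2.2 (Flow.omegaLimit_subset_of_isClosed (C := {y | 0 ≤ P y})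
    (isClosed_le continuous_const h.contP) (Eventually.of_forall hcon) hy).not_gt

theorem isOpen_exists_P_neg (h : IsWarpedFlow m n φ A B P Q) :
    IsOpen {x | ∃ t, P (φ t x) < 0} := by
  simp only [ofPred_exists]
  exact isOpen_iUnion fun t =>
    isOpen_lt (h.contP.comp (φ.continuous_toFun t)) continuous_const

end IsWarpedFlow

variable {m n : ℕ} {φ : Flow ℝ (closedStateSpace m n (-1) (-1))}

theorem IsSystemFlow.isWarpedFlow (hm : 1 < m) (hn : 1 < n)
    (hφ : IsSystemFlow m n (-1) (-1) φ) :
    IsWarpedFlow m n φ (fun x => x.1 0) (fun x => x.1 1) (fun x => x.1 2) (fun x => x.1 3) := by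
  have hd := fun x t i => hasDerivAt_pi.1 (hφ x t) i
  have hmem := fun x : closedStateSpace m n (-1) (-1) => closedStateSpace_subset _ _ _ _ x.2
  constructor
  · exact_mod_cast hm
  · exact_mod_cast hn
  iterate 4 exact (continuous_apply _).comp continuous_subtype_val
  · intro x t
    simpa [vectorField, shearSum] using hd x t 0
  · intro x t
    simpa [vectorField, shearSum] using hd x t 1
  · intro x t
    convert! hd x t 2 using 1
    simp only [vectorField, shearSum, Matrix.cons_val]
    ring
  · intro x t
    convert! hd x t 3 using 1
    simp only [vectorField, shearSum, Matrix.cons_val]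
    ring
  · intro x
    have := (hmem x).1
    simp only [traceConstraint] at this
    linarith
  · intro x
    have := (hmem x).2.1
    simp only [hamiltonianConstraint, shearSum] at this
    linarith
  · exact fun x => (hmem x).2.2.1
  · exact fun x => (hmem x).2.2.2
  · intro x y h0 h1 h2 h3
    ext i
    fin_cases i
    exacts [h0, h1, h2, h3]
  · intro a b p q ha hb h1 h2
    refine ⟨⟨![a, b, p, q], subset_closure ⟨?_, ?_, ha, hb⟩⟩, rfl, rfl, rfl, rfl⟩
    · simp only [traceConstraint, Matrix.cons_val]
      linarith
    · simp only [hamiltonianConstraint, shearSum, Matrix.cons_val]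
      linarith

theorem dense_interior : Dense {x : closedStateSpace m n (-1) (-1) | x.1 0 ≠ 0 ∧ x.1 1 ≠ 0} := by
  intro x
  rw [closure_subtype]
  refine closure_mono (fun y hy => ?_) x.2
  exact ⟨⟨y, subset_closure hy⟩, ⟨hy.2.2.1.ne', hy.2.2.2.ne'⟩, rfl⟩

theorem image_val_eq_singleton {X : Set State} {s : Set X} {p : State} (hs : s.Nonempty) :
    Subtype.val '' s = {p} ↔ ∀ y ∈ s, y.1 = p := by
  rw [hs.image Subtype.val |>.subset_singleton_iff.symm, image_subset_iff]
  rfl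

section Equilibria

variable {x : closedStateSpace m n (-1) (-1)}

theorem eq_FA_iff (h : IsWarpedFlow m n φ (fun x => x.1 0) (fun x => x.1 1) (fun x => x.1 2)
    (fun x => x.1 3)) : x.1 = FA m n ↔ x.1 0 = 0 ∧ x.1 2 = 0 := by
  refine ⟨fun e => by simp [e, FA], fun ⟨h0, h2⟩ => ?_⟩
  obtain ⟨h1, h3⟩ := h.eq_of_A_eq_zero_of_P_eq_zero h0 h2
  ext i
  fin_cases i
  exacts [h0, h1, h2, h3]

theorem eq_FB_iff (h : IsWarpedFlow m n φ (fun x => x.1 0) (fun x => x.1 1) (fun x => x.1 2)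
    (fun x => x.1 3)) : x.1 = FB m n ↔ x.1 1 = 0 ∧ x.1 3 = 0 := by
  refine ⟨fun e => by simp [e, FB], fun ⟨h1, h3⟩ => ?_⟩
  obtain ⟨h0, h2⟩ := h.symm.eq_of_A_eq_zero_of_P_eq_zero h1 h3
  rw [add_comm (n : ℝ)] at h0
  ext i
  fin_cases i
  exacts [h0, h1, h2, h3]

theorem eq_F2_iff (h : IsWarpedFlow m n φ (fun x => x.1 0) (fun x => x.1 1) (fun x => x.1 2)
    (fun x => x.1 3)) : x.1 = F2 m n ↔ x.1 0 = 0 ∧ x.1 1 = 0 ∧ x.1 2 < 0 := by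
  constructor
  · intro e
    have h0 : x.1 0 = 0 := by simp [e, F2]
    have h1 : x.1 1 = 0 := by simp [e, F2]
    refine ⟨h0, h1, (h.P_neg_or_Q_neg h0 h1).resolve_right (not_lt.2 ?_)⟩
    simp only [e, F2, Matrix.cons_val]
    positivity
  · rintro ⟨h0, h1, h2⟩
    obtain ⟨h2, h3⟩ := h.eq_of_P_neg h0 h1 h2
    ext i
    fin_cases i
    exacts [h0, h1, h2, h3]

theorem eq_F1_iff (h : IsWarpedFlow m n φ (fun x => x.1 0) (fun x => x.1 1) (fun x => x.1 2)
    (fun x => x.1 3)) : x.1 = F1 m n ↔ x.1 0 = 0 ∧ x.1 1 = 0 ∧ x.1 3 < 0 := by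
  constructor
  · intro e
    have h0 : x.1 0 = 0 := by simp [e, F1]
    have h1 : x.1 1 = 0 := by simp [e, F1]
    refine ⟨h0, h1, (h.P_neg_or_Q_neg h0 h1).resolve_left (not_lt.2 ?_)⟩
    simp only [e, F1, Matrix.cons_val]
    positivity
  · rintro ⟨h0, h1, h3⟩
    obtain ⟨h3, h2⟩ := h.symm.eq_of_P_neg h1 h0 h3
    rw [add_comm (n : ℝ), mul_comm (n : ℝ) m] at h2 h3
    ext i
    fin_cases i
    exacts [h0, h1, h2, h3]

theorem eq_Fstar_iff : x.1 = Fstar m n ↔ x.1 0 = 1 / (m + n) ∧ x.1 1 = 1 / (m + n) ∧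
    x.1 2 = 1 / (m + n) ∧ x.1 3 = 1 / (m + n) := by
  refine ⟨fun e => by simp [e, Fstar], fun ⟨h0, h1, h2, h3⟩ => ?_⟩
  ext i
  fin_cases i
  exacts [h0, h1, h2, h3]

end Equilibria

end WarpedProduct

/-! ### Assembly of the theorem. -/

open WarpedProduct in
theorem mainTheorem2 (m n : ℕ) (hm : 1 < m) (hn : 1 < n) :
    -- the system defines a unique (complete) flow on the closed state space
    (∃! φ : Flow ℝ (WarpedProduct.closedStateSpace m n (-1) (-1)),
      WarpedProduct.IsSystemFlow m n (-1) (-1) φ) ∧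
    ∀ φ : Flow ℝ (WarpedProduct.closedStateSpace m n (-1) (-1)),
      WarpedProduct.IsSystemFlow m n (-1) (-1) φ →
      -- orbits on the boundary `A = 0`
      (∀ x : WarpedProduct.closedStateSpace m n (-1) (-1),
        x.1 0 = 0 → x.1 1 ≠ 0 → x.1 ≠ WarpedProduct.FA m n →
          WarpedProduct.alphaSet φ x = {WarpedProduct.FA m n} ∧
          (WarpedProduct.omegaSet φ x = {WarpedProduct.F1 m n} ∨
            WarpedProduct.omegaSet φ x = {WarpedProduct.F2 m n})) ∧
      -- orbits on the boundary `B = 0`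
      (∀ x : WarpedProduct.closedStateSpace m n (-1) (-1),
        x.1 0 ≠ 0 → x.1 1 = 0 → x.1 ≠ WarpedProduct.FB m n →
          WarpedProduct.alphaSet φ x = {WarpedProduct.FB m n} ∧
          (WarpedProduct.omegaSet φ x = {WarpedProduct.F1 m n} ∨
            WarpedProduct.omegaSet φ x = {WarpedProduct.F2 m n})) ∧
      -- interior orbits: the `α`-limit
      (∀ x : WarpedProduct.closedStateSpace m n (-1) (-1),
        x.1 0 * x.1 1 ≠ 0 → x.1 ≠ WarpedProduct.Fstar m n →
          WarpedProduct.alphaSet φ x = {WarpedProduct.Fstar m n}) ∧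
      -- exactly one interior orbit has `ω`-limit `F_A`
      (∃! O : Set (WarpedProduct.closedStateSpace m n (-1) (-1)),
        ∃ x : WarpedProduct.closedStateSpace m n (-1) (-1),
          x.1 0 * x.1 1 ≠ 0 ∧ O = φ.orbit x ∧
            WarpedProduct.omegaSet φ x = {WarpedProduct.FA m n}) ∧
      -- exactly one interior orbit has `ω`-limit `F_B`
      (∃! O : Set (WarpedProduct.closedStateSpace m n (-1) (-1)),
        ∃ x : WarpedProduct.closedStateSpace m n (-1) (-1),
          x.1 0 * x.1 1 ≠ 0 ∧ O = φ.orbit x ∧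
            WarpedProduct.omegaSet φ x = {WarpedProduct.FB m n}) ∧
      -- all other interior orbits except `F_*` end at `F_1` or `F_2`
      (∀ x : WarpedProduct.closedStateSpace m n (-1) (-1),
        x.1 0 * x.1 1 ≠ 0 → x.1 ≠ WarpedProduct.Fstar m n →
          WarpedProduct.omegaSet φ x ≠ {WarpedProduct.FA m n} →
          WarpedProduct.omegaSet φ x ≠ {WarpedProduct.FB m n} →
          WarpedProduct.omegaSet φ x = {WarpedProduct.F1 m n} ∨
            WarpedProduct.omegaSet φ x = {WarpedProduct.F2 m n}) ∧
      -- these orbits fill an open dense set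
      (IsOpen {x : WarpedProduct.closedStateSpace m n (-1) (-1) | x.1 0 * x.1 1 ≠ 0 ∧
          (WarpedProduct.omegaSet φ x = {WarpedProduct.F1 m n} ∨
            WarpedProduct.omegaSet φ x = {WarpedProduct.F2 m n})} ∧
        Dense {x : WarpedProduct.closedStateSpace m n (-1) (-1) | x.1 0 * x.1 1 ≠ 0 ∧
          (WarpedProduct.omegaSet φ x = {WarpedProduct.F1 m n} ∨
            WarpedProduct.omegaSet φ x = {WarpedProduct.F2 m n})}) := by
  refine ⟨existsUnique_isSystemFlow hm hn, fun φ hφ => ?_⟩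
  have h := hφ.isWarpedFlow hm hn
  have : CompactSpace (closedStateSpace m n (-1) (-1)) :=
    isCompact_iff_compactSpace.1 (isCompact_closedStateSpace hm hn)
  have hne : ∀ (f : Filter ℝ) [f.NeBot] (x : closedStateSpace m n (-1) (-1)),
      (ω f φ {x}).Nonempty := fun f _ x => nonempty_omegaLimit f φ {x} (singleton_nonempty x)
  have hF2 := fun x => h.exists_P_neg_iff (hne atTop x)
  have hF1 : ∀ x : closedStateSpace m n (-1) (-1), (∃ t, (φ t x).1 3 < 0) ↔
      ∀ y ∈ ω⁺ φ {x}, y.1 0 = 0 ∧ y.1 1 = 0 ∧ y.1 3 < 0 := fun x =>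
    (h.symm.exists_P_neg_iff (hne atTop x)).trans
      (forall₂_congr fun _ _ => and_left_comm)
  simp only [alphaSet, omegaSet, image_val_eq_singleton (hne _ _), eq_FA_iff h, eq_FB_iff h,
    eq_F1_iff h, eq_F2_iff h, eq_Fstar_iff, ne_eq, mul_eq_zero, not_or]
  simp only [← hF1, ← hF2]
  obtain ⟨xA, hA0, hA1, hωA⟩ := h.exists_omegaLimit
  obtain ⟨xB, hB1, hB0, hωB⟩ := h.symm.exists_omegaLimit
  refine ⟨fun x h0 h1 h2 => ?_, fun x h0 h1 h2 => ?_, fun x h0 h1 => ?_, ?_, ?_,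
    fun x h0 h1 h2 h3 => ?_, ?_, ?_⟩
  · refine ⟨h.alphaLimit_of_A_eq_zero h0 h1, ?_⟩
    rw [hF1, hF2]
    exact (h.omegaLimit_of_A_eq_zero h0 fun h3 => h2 ⟨h0, h3⟩).symm
  · refine ⟨h.symm.alphaLimit_of_A_eq_zero h1 h0, ?_⟩
    have := h.symm.omegaLimit_of_A_eq_zero h1 fun h3 => h2 ⟨h1, h3⟩
    rw [hF1, hF2]
    exact this.imp (fun H y hy => and_left_comm.1 (H y hy))
      fun H y hy => and_left_comm.1 (H y hy)
  · exact h.alphaLimit_of_ne_zero h0.1 h0.2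
  · refine ⟨φ.orbit xA, ⟨xA, ⟨hA0, hA1⟩, rfl, hωA⟩, ?_⟩
    rintro _ ⟨x, hx, rfl, hωx⟩
    exact h.mem_orbit_of_omegaLimit hx.1 hA0 hωx hωA
  · refine ⟨φ.orbit xB, ⟨xB, ⟨hB0, hB1⟩, rfl, hωB⟩, ?_⟩
    rintro _ ⟨x, hx, rfl, hωx⟩
    exact h.symm.mem_orbit_of_omegaLimit hx.2 hB1 hωx hωB
  · rcases h.omegaLimit_cases h0.1 h0.2 h1 with h4 | h4 | h4 | h4
    exacts [Or.inr h4, Or.inl h4, absurd h4 h2, absurd h4 h3]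
  · have h0 : IsOpen {x : closedStateSpace m n (-1) (-1) | ¬ x.1 0 = 0 ∧ ¬ x.1 1 = 0} :=
      (isOpen_ne_fun h.contA continuous_const).inter (isOpen_ne_fun h.contB continuous_const)
    exact h0.inter (h.symm.isOpen_exists_P_neg.union h.isOpen_exists_P_neg)
  · have hpos : (0 : ℝ) < m + n := by
      have := h.hm
      have := h.hn
      linarith
    obtain ⟨xs, hs⟩ := h.surj (1 / (m + n)) (1 / (m + n)) (1 / (m + n)) (1 / (m + n))
      (by positivity) (by positivity) (by field_simp) (by field_simp; ring)
    -- The exceptional interior orbits are those tending to `F_A` and `F_B`, and the fixed point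
    -- `F_*`.
    refine h.dense_of_compl_subset_orbits dense_interior (x := xA) (y := xB) (z := xs)
      fun w h0 h1 hw => ?_
    by_cases hstar : w.1 0 = 1 / (m + n) ∧ w.1 1 = 1 / (m + n) ∧ w.1 2 = 1 / (m + n) ∧
      w.1 3 = 1 / (m + n)
    · refine Or.inr (Or.inr ?_)
      rw [h.eq_of_A_eq_of_P_eq (hstar.1.trans hs.1.symm) (hstar.2.2.1.trans hs.2.2.1.symm)]
      exact φ.mem_orbit_self xs
    rcases h.omegaLimit_cases h0 h1 hstar with h4 | h4 | h4 | h4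
    · exact absurd ⟨⟨h0, h1⟩, Or.inr h4⟩ hw
    · exact absurd ⟨⟨h0, h1⟩, Or.inl h4⟩ hw
    · left
      rw [← h.mem_orbit_of_omegaLimit h0 hA0 h4 hωA]
      exact φ.mem_orbit_self w
    · right
      left
      rw [← h.symm.mem_orbit_of_omegaLimit h1 hB1 h4 hωB]
      exact φ.mem_orbit_self w
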